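/- Let $d\ge 1$. Consider a Poisson multi-Bernoulli mixture (PMBM) on $\mathbb{R}^{d}$ with: an integrable PPP intensity $\lambda\ge 0$; $n$ potential targets; finitely many local hypotheses $a^i\in\{1,\dots,h^i\}$ for the $i$-th one, with existence probability $r^{i,a^i}\in[0,1]$ and Gaussian single-target density $p^{i,a^i}=\mathcal{N}(\cdot\,;\overline{x}^{i,a^i},P^{i,a^i})$, $P^{i,a^i}$ positive definite; a finite set $\mathcal{A}$ of global hypotheses $a=(a^1,\dots,a^n)$ with weights $w^a\ge 0$, $\sum_{a\in\mathcal{A}}w^a=1$. For each $a\in\mathcal{A}$ let $\pi_a$ be a permutation of $\{1,\dots,n\}$, and write $a_i:=(\pi_a(i),a^{\pi_a(i)})$ for the component it assigns to index $i$. For a finite set $\widetilde X\subset\{0,1,\dots,n\}\times\mathbb{R}^{d}$ of targets $(u,x)$ with track index $u$, let $\widetilde X^{u}$ be the subset of its elements with track index $u$. Given an intensity $\mu$, put $\widetilde{f}^{\mathrm p}_{\mu}(\widetilde Y)=e^{-\int\mu}\prod_{(u,x)\in\widetilde Y}\delta_0[u]\mu(x)$. Given $r\in[0,1]$ and a probability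 density $p$ on $\mathbb{R}^d$, let $\mathrm{B}^{i}_{r,p}$ be the function on finite sets of targets with track index equal to $1-r$ at $\emptyset$, to $r\,p(x)\,\delta_i[u]$ at $\{(u,x)\}$, and to $0$ at all other sets. Put $$\widetilde f^{\pi}(\widetilde X,a)=\widetilde f^{\mathrm p}_{\lambda}(\widetilde X^{0})\,w^a\prod_{i=1}^{n}\mathrm{B}^{i}_{r^{a_i},p^{a_i}}(\widetilde X^{i}),\qquad \widetilde q(\widetilde X,a)=w_q^a\,\widetilde f^{\mathrm p}_{\lambda^q}(\widetilde X^{0})\prod_{i=1}^{n}\mathrm{B}^{i}_{r_q^i,p_q^i}(\widetilde X^{i}).$$ Here $\widetilde q$ is a PMB density with parameters $w_q^a\ge0$, $\sum_{a}w_q^a=1$, an integrable intensity $\lambda^q\ge 0$, $r_q^i\in[0,1]$, and single-target densities constrained to be Gaussian, $p_q^i=\mathcal{N}(\cdot\,;\overline{x}_q^i,P_q^i)$ with $P_q^i$ positive definite. Let $$\mathrm D(\widetilde f^{\pi}\|\widetilde q)=\sum_{a\in\mathcal A}\int\widetilde f^{\pi}(\widetilde X,a)\log\frac{\widetilde f^{\pi}(\widetilde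 X,a)}{\widetilde q(\widetilde X,a)}\,\delta\widetilde X\in[0,\infty],$$ where $\int g(\widetilde X)\,\delta\widetilde X=\sum_{m\ge0}\frac1{m!}\int g(\{y_1,\dots,y_m\})\,dy_1\cdots dy_m$ is the set integral, and integration over $y=(u,x)$ means summation over $u$ and Lebesgue integration over $x$. Then, for the fixed permutations $\pi$, there is a minimiser of $\mathrm D(\widetilde f^{\pi}\|\widetilde q)$ over all such $\widetilde q$. Moreover, $\widetilde q$ is a minimiser if and only if $w_q^a=w^a$ for all $a\in\mathcal{A}$, $\lambda^q=\lambda$ almost everywhere, and for all $i$ $$r_q^i=r^i:=\sum_{a\in\mathcal A}w^a r^{a_i},$$ and, for all $i$ with $r^i\neq0$, $$\overline{x}_q^i=\frac1{r^i}\sum_{a\in\mathcal A}w^a r^{a_i}\,\overline{x}^{a_i},\qquad P_q^i=\frac1{r^i}\sum_{a\in\mathcal A}w^a r^{a_i}\Big[P^{a_i}+\big(\overline{x}^{a_i}-\overline{x}_q^i\big)\big(\overline{x}^{a_i}-\overline{x}_q^i\big)^{T}\Big].$$ -/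

import Mathlib

open MeasureTheory
open scoped ENNReal Nat Matrix

noncomputable section

/-- The Gaussian density `𝒩(x; m, P)` on `ℝᵈ` with mean `m` and (positive definite) covariance
matrix `P`, with respect to Lebesgue measure. -/
def gaussianDensity {d : ℕ} (m : Fin d → ℝ) (P : Matrix (Fin d) (Fin d) ℝ) (x : Fin d → ℝ) : ℝ :=
  (Real.sqrt ((2 * Real.pi) ^ d * P.det))⁻¹ *
    Real.exp (-((x - m) ⬝ᵥ (P⁻¹ *ᵥ (x - m))) / 2)

/-- The parameters of a Bernoulli density on finite subsets of `ℝᵈ`: a probability of existence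
and a single-target probability density. -/
structure BernoulliParam (d : ℕ) where
  /-- probability of existence -/
  r : ℝ
  /-- single-target density -/
  p : (Fin d → ℝ) → ℝ
  r_nonneg : 0 ≤ r
  r_le_one : r ≤ 1
  p_measurable : Measurable p
  p_nonneg : ∀ x, 0 ≤ p x
  p_integral : ∫ x, p x = 1

/-- The intensity of a Poisson point process (with finite expected number of points) on `ℝᵈ`. -/
structure PPPIntensity (d : ℕ) where
  /-- intensity function -/
  val : (Fin d → ℝ) → ℝ
  measurable : Measurable val
  nonneg : ∀ x, 0 ≤ val x
  integrable : Integrable val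

/-- A Poisson multi-Bernoulli mixture on `ℝᵈ`. There are `n` potential targets, the `i`-th one has
`h i` local hypotheses, each with its Bernoulli density; a global hypothesis picks one local
hypothesis per potential target, `A` is the finite set of global hypotheses, and `w` their
weights. -/
structure PMBM (d : ℕ) where
  /-- PPP intensity -/
  intensity : PPPIntensity d
  /-- number of potential targets -/
  n : ℕ
  /-- number of local hypotheses of each potential target -/
  h : Fin n → ℕ
  /-- Bernoulli density of each potential target given each of its local hypotheses -/
  bern : (i : Fin n) → Fin (h i) → BernoulliParam d
  /-- global hypotheses -/
  A : Finset ((i : Fin n) → Fin (h i))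
  /-- weights of the global hypotheses -/
  w : A → ℝ
  w_nonneg : ∀ a, 0 ≤ w a
  w_sum : ∑ a, w a = 1

/-- One permutation `π_a` of the potential targets for each global hypothesis `a`. -/
abbrev PMBM.Permutations {d : ℕ} (f : PMBM d) : Type := f.A → Equiv.Perm (Fin f.n)

/-- The Bernoulli component `(π_a(i), a^{π_a(i)})`. -/
def PMBM.permBern {d : ℕ} (f : PMBM d) (π : f.Permutations) (a : f.A) (i : Fin f.n) :
    BernoulliParam d :=
  f.bern (π a i) (a.1 (π a i))

/-- The parameters of a PMB approximation on the augmented space of a PMBM `f`: weights of the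
global hypotheses of `f`, a PPP intensity, and one Bernoulli density for each potential target of
`f`. The PPP and the Bernoulli densities do not depend on the global hypothesis. -/
structure PMB {d : ℕ} (f : PMBM d) where
  /-- weights `w_q` -/
  w : f.A → ℝ
  w_nonneg : ∀ a, 0 ≤ w a
  w_sum : ∑ a, w a = 1
  /-- PPP intensity -/
  intensity : PPPIntensity d
  /-- Bernoulli densities -/
  bern : Fin f.n → BernoulliParam d

/-- A single target with its track index `u ∈ {0, 1, …, n}`. The index `0` marks undetected
targets; the `i`-th potential target, `i : Fin n`, has track index `i.succ`. -/
abbrev AugTarget (n d : ℕ) : Type := Fin (n + 1) × (Fin d → ℝ)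

/-- The PPP density `e^{-∫λ} ∏_{(u,x) ∈ Y} δ₀[u] λ(x)` on finite sets of targets with track
indices. -/
def augPPP {d : ℕ} (n : ℕ) (lam : PPPIntensity d) (Y : Finset (AugTarget n d)) : ℝ :=
  Real.exp (-∫ x, lam.val x) * ∏ y ∈ Y, (if y.1 = 0 then 1 else 0) * lam.val y.2

/-- The Bernoulli density with track index `i` on finite sets of targets with track indices:
`1 - r` at `∅`, `r p(x) δ_i[u]` at `{(u, x)}` and `0` at sets with two or more elements
(for a singleton, the sum below has exactly one term). -/
def augBernoulli {d n : ℕ} (i : Fin n) (b : BernoulliParam d) (X : Finset (AugTarget n d)) : ℝ :=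
  if X.card = 0 then 1 - b.r
  else if X.card = 1 then ∑ y ∈ X, b.r * b.p y.2 * (if y.1 = i.succ then 1 else 0)
  else 0

/-- The targets of `X` with track index `u`. -/
def track {n d : ℕ} (u : Fin (n + 1)) (X : Finset (AugTarget n d)) : Finset (AugTarget n d) :=
  X.filter (fun y => y.1 = u)

/-- The density of the PMBM `f` with permutations `π` on the augmented space of pairs `(X, a)` of
a finite set of targets with track indices and a global hypothesis. -/
def PMBM.augDensity {d : ℕ} (f : PMBM d) (π : f.Permutations)
    (X : Finset (AugTarget f.n d)) (a : f.A) : ℝ :=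
  augPPP f.n f.intensity (track 0 X) * f.w a *
    ∏ i : Fin f.n, augBernoulli i (f.permBern π a i) (track i.succ X)

/-- The density of a PMB on the augmented space. -/
def PMB.augDensity {d : ℕ} {f : PMBM d} (q : PMB f)
    (X : Finset (AugTarget f.n d)) (a : f.A) : ℝ :=
  q.w a * augPPP f.n q.intensity (track 0 X) *
    ∏ i : Fin f.n, augBernoulli i (q.bern i) (track i.succ X)

/-- The set integral `∫ g(X) δX = ∑_m (1/m!) ∫ g({x₁,…,x_m}) dx₁ ⋯ dx_m` of a
`[0,∞]`-valued function of a finite subset of `S`, with reference measure `μ` on `S`. -/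
def setLIntegral {S : Type*} [DecidableEq S] [MeasurableSpace S] (μ : Measure S)
    (g : Finset S → ℝ≥0∞) : ℝ≥0∞ :=
  ∑' m : ℕ, ((m ! : ℕ) : ℝ≥0∞)⁻¹ *
    ∫⁻ x : Fin m → S, g (Finset.univ.image x) ∂(Measure.pi fun _ => μ)

/-- The set integral of an extended-real-valued function: the set integral of its positive part
minus that of its negative part. -/
def setIntegral {S : Type*} [DecidableEq S] [MeasurableSpace S] (μ : Measure S)
    (g : Finset S → EReal) : EReal :=
  ((setLIntegral μ fun X => (g X).toENNReal : ℝ≥0∞) : EReal) -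
    ((setLIntegral μ fun X => (-g X).toENNReal : ℝ≥0∞) : EReal)

/-- Reference measure for a target with track index: sum over `u`, Lebesgue measure in `x`. -/
def augMeasure (n d : ℕ) : Measure (AugTarget n d) :=
  (Measure.count : Measure (Fin (n + 1))).prod (volume : Measure (Fin d → ℝ))

/-- The integrand `s log (s / t)` of the KLD of nonnegative densities, with the usual conventions
`0 log (0 / t) = 0` and `s log (s / 0) = ∞` for `s > 0`. -/
def kldIntegrand (s t : ℝ) : EReal :=
  if s = 0 then 0 else if t = 0 then ⊤ else ((s * Real.log (s / t) : ℝ) : EReal)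

/-- The Kullback-Leibler divergence `D(f̃^π ‖ q̃)` on the augmented space. -/
def kld {d : ℕ} (f : PMBM d) (π : f.Permutations) (q : PMB f) : EReal :=
  ∑ a : f.A, setIntegral (augMeasure f.n d) fun X =>
    kldIntegrand (f.augDensity π X a) (q.augDensity X a)

/-- The single-target densities of the PMB are Gaussian. -/
def PMB.IsGaussian {d : ℕ} {f : PMBM d} (q : PMB f) : Prop :=
  ∀ i, ∃ (m : Fin d → ℝ) (P : Matrix (Fin d) (Fin d) ℝ),
    P.PosDef ∧ (q.bern i).p = gaussianDensity m P

/-- `q` minimises the KLD from the PMBM with permutations `π` among all PMBs with Gaussian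
single-target densities. -/
def IsOptimalGaussianPMB {d : ℕ} (f : PMBM d) (π : f.Permutations) (q : PMB f) : Prop :=
  q.IsGaussian ∧ ∀ q' : PMB f, q'.IsGaussian → kld f π q ≤ kld f π q'

/-- `rⁱ = ∑_a w^a r^{π_a(i), a^{π_a(i)}}`. -/
def matchedExistence {d : ℕ} (f : PMBM d) (π : f.Permutations) (i : Fin f.n) : ℝ :=
  ∑ a : f.A, f.w a * (f.permBern π a i).r

/-- `(1 / rⁱ) ∑_a w^a r^{π_a(i), a^{π_a(i)}} x̄^{π_a(i), a^{π_a(i)}}`. -/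
def matchedMean {d : ℕ} (f : PMBM d) (π : f.Permutations)
    (xbar : (i : Fin f.n) → Fin (f.h i) → Fin d → ℝ) (i : Fin f.n) : Fin d → ℝ :=
  (1 / matchedExistence f π i) •
    ∑ a : f.A, (f.w a * (f.permBern π a i).r) • xbar (π a i) (a.1 (π a i))

/-- `(1 / rⁱ) ∑_a w^a r^{π_a(i), a^{π_a(i)}} [P + (x̄ - x̄ⁱ) (x̄ - x̄ⁱ)ᵀ]`, where `x̄` and `P` are
those of the component `(π_a(i), a^{π_a(i)})` and `x̄ⁱ` is the matched mean. -/
def matchedCov {d : ℕ} (f : PMBM d) (π : f.Permutations)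
    (xbar : (i : Fin f.n) → Fin (f.h i) → Fin d → ℝ)
    (P : (i : Fin f.n) → Fin (f.h i) → Matrix (Fin d) (Fin d) ℝ) (i : Fin f.n) :
    Matrix (Fin d) (Fin d) ℝ :=
  (1 / matchedExistence f π i) •
    ∑ a : f.A, (f.w a * (f.permBern π a i).r) •
      (P (π a i) (a.1 (π a i)) +
        Matrix.vecMulVec (xbar (π a i) (a.1 (π a i)) - matchedMean f π xbar i)
          (xbar (π a i) (a.1 (π a i)) - matchedMean f π xbar i))

end

/-! Both densities on the augmented space are products: a weight, the factor `e^{-∫λ}`, one factor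
per point (`λ(x)` on track `0`, `r p(x)` on track `i`), and one factor `1 - r` per empty track.
Hence the logarithm of their ratio is a constant, plus a sum over points, plus a sum over empty
tracks. Campbell's formula integrates such a function against a Poisson multi-Bernoulli density
(`setLIntegral_pmbDensity_mul`), so the divergence splits into separate problems for the weights,
the intensity and each track.

For the weights and the intensity, Gibbs' inequality applies: `s log (s/t) - s + t ≥ 0`, with
equality only for `s = t`. The correction `-s + t` is harmless, since both families of weights sum
to `1` and since `e^{-∫λ}` supplies exactly the missing masses of the intensities.

On track `i`, the logarithm of the Gaussian Bernoulli density of `q` involves `log (1 - r')`, `log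
r'` and a quadratic polynomial in `x`. Its average over the mixture of the components assigned to
`i` therefore depends only on the existence probability and the first two moments of the mixture.
Replacing the mixture by the one Gaussian Bernoulli density with the same moments changes the
divergence by a constant independent of `q` (`sum_bernoulli_divergence_eq`). What remains is the
divergence between two Gaussian Bernoulli densities, which is nonnegative and vanishes exactly at
equal parameters; its Gaussian part carries the factor `r^i`, so mean and covariance are free when
`r^i = 0`.

Altogether the divergence is `minimalDivergence + divergenceExcess` when finite
(`sum_pmbDivergence_eq`), and the excess is zero exactly for matched parameters. The negative part
of the integrand always has finite integral, because `s log (t/s) ≤ t`; so the divergence is either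
`⊤` or given by this computation with real numbers, and the matched parameters are in the second
case. -/

noncomputable section

/-! ### Linearity and monotonicity of the set integral -/

section SetMeasurability

variable {S : Type*} [MeasurableSpace S] {μ : Measure S} [DecidableEq S]

/-- Measurability of a function of a finite set, as a function of tuples of any length. -/
def SetAEMeasurable (μ : Measure S) (g : Finset S → ℝ≥0∞) : Prop :=
  ∀ m : ℕ, AEMeasurable (fun x : Fin m → S => g (Finset.univ.image x)) (Measure.pi fun _ => μ)

theorem SetAEMeasurable.add {g h : Finset S → ℝ≥0∞} (hg : SetAEMeasurable μ g)
    (hh : SetAEMeasurable μ h) : SetAEMeasurable μ fun X => g X + h X :=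
  fun m => (hg m).add (hh m)

theorem SetAEMeasurable.mul {g h : Finset S → ℝ≥0∞} (hg : SetAEMeasurable μ g)
    (hh : SetAEMeasurable μ h) : SetAEMeasurable μ fun X => g X * h X :=
  fun m => (hg m).mul (hh m)

theorem SetAEMeasurable.const_mul {g : Finset S → ℝ≥0∞} (hg : SetAEMeasurable μ g) (c : ℝ≥0∞) :
    SetAEMeasurable μ fun X => c * g X :=
  fun m => (hg m).const_mul c

theorem SetAEMeasurable.sum {ι : Type*} (s : Finset ι) {g : ι → Finset S → ℝ≥0∞}
    (hg : ∀ i, SetAEMeasurable μ (g i)) : SetAEMeasurable μ fun X => ∑ i ∈ s, g i X :=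
  fun m => Finset.aemeasurable_fun_sum s fun i _ => hg i m

theorem setLIntegral_add_left {g h : Finset S → ℝ≥0∞} (hg : SetAEMeasurable μ g) :
    setLIntegral μ (fun X => g X + h X) = setLIntegral μ g + setLIntegral μ h := by
  unfold setLIntegral
  rw [← ENNReal.tsum_add]
  congr with m
  rw [lintegral_add_left' (hg m), mul_add]

theorem setLIntegral_add_right {g h : Finset S → ℝ≥0∞} (hh : SetAEMeasurable μ h) :
    setLIntegral μ (fun X => g X + h X) = setLIntegral μ g + setLIntegral μ h := by
  simp only [add_comm (g _)]
  rw [setLIntegral_add_left hh, add_comm]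

theorem setLIntegral_const_mul {g : Finset S → ℝ≥0∞} (hg : SetAEMeasurable μ g) (c : ℝ≥0∞) :
    setLIntegral μ (fun X => c * g X) = c * setLIntegral μ g := by
  unfold setLIntegral
  rw [← ENNReal.tsum_mul_left]
  congr with m
  rw [lintegral_const_mul'' _ (hg m), mul_left_comm]

theorem setLIntegral_sum {ι : Type*} (s : Finset ι) {g : ι → Finset S → ℝ≥0∞}
    (hg : ∀ i, SetAEMeasurable μ (g i)) :
    setLIntegral μ (fun X => ∑ i ∈ s, g i X) = ∑ i ∈ s, setLIntegral μ (g i) := by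
  classical
  induction s using Finset.induction_on with
  | empty => simp [setLIntegral]
  | insert i s hi ih =>
    simp only [Finset.sum_insert hi]
    rw [setLIntegral_add_left (hg i), ih]

theorem setLIntegral_mono {g h : Finset S → ℝ≥0∞} (hgh : ∀ X, g X ≤ h X) :
    setLIntegral μ g ≤ setLIntegral μ h :=
  ENNReal.tsum_le_tsum fun _ => mul_le_mul_right (lintegral_mono fun _ => hgh _) _

end SetMeasurability

/-! ### Tuples of distinct points and Campbell's formula -/

section SetIntegral

variable {S : Type*} [MeasurableSpace S] {μ : Measure S} [SigmaFinite μ]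

theorem lintegral_pi_prod {m : ℕ} {g : Fin m → S → ℝ≥0∞} (hg : ∀ j, Measurable (g j)) :
    ∫⁻ x : Fin m → S, ∏ j, g j (x j) ∂(Measure.pi fun _ => μ) = ∏ j, ∫⁻ y, g j y ∂μ := by
  induction m with
  | zero => simp
  | succ m ih =>
    rw [← ((measurePreserving_piFinSuccAbove (fun _ : Fin (m + 1) => μ) 0).symm).lintegral_comp_emb
      (MeasurableEquiv.measurableEmbedding _)]
    simp only [MeasurableEquiv.piFinSuccAbove_symm_apply, Fin.insertNthEquiv_zero,
      Fin.consEquiv_apply, Fin.prod_univ_succ, Fin.cons_zero, Fin.cons_succ]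
    have h : AEMeasurable (fun x : Fin m → S => ∏ j : Fin m, g j.succ (x j))
        (Measure.pi fun _ => μ) :=
      (Finset.measurable_fun_prod _ fun j _ =>
        (hg j.succ).comp (measurable_pi_apply j)).aemeasurable
    rw [lintegral_prod_mul (f := g 0) (g := fun x : Fin m → S => ∏ j : Fin m, g j.succ (x j))
      (hg 0).aemeasurable h, ih fun j => hg j.succ]

theorem lintegral_pi_prod_eq_pow {g : S → ℝ≥0∞} (hg : Measurable g) (m : ℕ) :
    ∫⁻ x : Fin m → S, ∏ j, g (x j) ∂(Measure.pi fun _ => μ) = (∫⁻ y, g y ∂μ) ^ m := by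
  rw [lintegral_pi_prod fun _ => hg, Finset.prod_const, Finset.card_univ, Fintype.card_fin]

variable [NullSingletonClass μ]

theorem ae_pi_forall_ne (m : ℕ) (y : S) :
    ∀ᵐ x ∂(Measure.pi fun _ : Fin m => μ), ∀ j, x j ≠ y :=
  ae_all_iff.2 fun j => Measure.ae_eval_ne (fun _ : Fin m => μ) j y

variable [MeasurableEq S]

/-- Singletons are null, so by Fubini the first coordinate almost surely avoids the others.
Consequently sums and products over the set `Finset.univ.image x` may be computed over the indices
of the tuple. -/
theorem ae_pi_injective (m : ℕ) :
    ∀ᵐ x ∂(Measure.pi fun _ : Fin m => μ), Function.Injective x := by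
  induction m with
  | zero => exact Filter.Eventually.of_forall fun x i => i.elim0
  | succ m ih =>
    have hmp := measurePreserving_piFinSuccAbove (fun _ : Fin (m + 1) => μ) 0
    have h1 : ∀ᵐ z ∂(μ.prod (Measure.pi fun _ : Fin m => μ)), Function.Injective z.2 :=
      Measure.quasiMeasurePreserving_snd.ae ih
    have h2 : ∀ᵐ z ∂(μ.prod (Measure.pi fun _ : Fin m => μ)), ∀ j, z.2 j ≠ z.1 := by
      refine ae_all_iff.2 fun j => ?_
      have hm : MeasurableSet {z : S × (Fin m → S) | z.2 j ≠ z.1} :=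
        (measurableSet_eq_fun (f := fun z : S × (Fin m → S) => z.2 j) (by fun_prop)
          measurable_fst).compl
      rw [Measure.ae_prod_iff_ae_ae hm]
      exact Filter.Eventually.of_forall fun y => Measure.ae_eval_ne (fun _ : Fin m => μ) j y
    filter_upwards [hmp.quasiMeasurePreserving.ae h1, hmp.quasiMeasurePreserving.ae h2]
      with x hx1 hx2
    have hx1' : Function.Injective fun j : Fin m => x j.succ := hx1
    have hx2' : ∀ j : Fin m, x j.succ ≠ x 0 := hx2
    intro i j hij
    induction i using Fin.cases with
    | zero =>
      induction j using Fin.cases with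
      | zero => rfl
      | succ j => exact absurd hij.symm (hx2' j)
    | succ i =>
      induction j using Fin.cases with
      | zero => exact absurd hij (hx2' i)
      | succ j => rw [hx1' hij]

variable [DecidableEq S]

theorem setAEMeasurable_sum_mem {G : S → ℝ≥0∞} (hG : Measurable G) :
    SetAEMeasurable μ fun X => ∑ y ∈ X, G y := by
  intro m
  refine AEMeasurable.congr (f := fun x : Fin m → S => ∑ j, G (x j))
    (Finset.measurable_fun_sum _ fun j _ => hG.comp (measurable_pi_apply j)).aemeasurable ?_
  filter_upwards [ae_pi_injective m] with x hx
  rw [Finset.sum_image hx.injOn]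

theorem inv_factorial_succ_mul (m : ℕ) :
    (((m + 1) ! : ℕ) : ℝ≥0∞)⁻¹ * ((m + 1 : ℕ) : ℝ≥0∞) = ((m ! : ℕ) : ℝ≥0∞)⁻¹ := by
  have h : ((m + 1 : ℕ) : ℝ≥0∞) ≠ 0 := by exact_mod_cast Nat.succ_ne_zero m
  rw [Nat.factorial_succ, Nat.cast_mul, ENNReal.mul_inv (Or.inl h)
    (Or.inl (ENNReal.natCast_ne_top _)), mul_right_comm,
    ENNReal.inv_mul_cancel h (ENNReal.natCast_ne_top _), one_mul]

/-- Campbell's formula for the set integral. -/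
theorem setLIntegral_sum_mem_mul {G : S → ℝ≥0∞} (hG : Measurable G)
    {g : Finset S → ℝ≥0∞} (hg : SetAEMeasurable μ g) :
    setLIntegral μ (fun X => (∑ y ∈ X, G y) * g X) =
      ∫⁻ y, G y * setLIntegral μ (fun X => g (insert y X)) ∂μ := by
  have himage (m : ℕ) (j : Fin (m + 1)) (z : S × (Fin m → S)) :
      Finset.univ.image ((MeasurableEquiv.piFinSuccAbove (fun _ : Fin (m + 1) => S) j).symm z) =
        insert z.1 (Finset.univ.image z.2) := by
    rw [MeasurableEquiv.piFinSuccAbove_symm_apply]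
    ext y
    simp [Fin.exists_iff_succAbove j, Fin.insertNthEquiv, eq_comm]
  have hmeas (m : ℕ) : AEMeasurable
      (fun z : S × (Fin m → S) => g (insert z.1 (Finset.univ.image z.2)))
      (μ.prod (Measure.pi fun _ => μ)) := by
    have := (hg (m + 1)).comp_quasiMeasurePreserving
      (measurePreserving_piFinSuccAbove (fun _ : Fin (m + 1) => μ) 0).symm.quasiMeasurePreserving
    refine this.congr (Filter.Eventually.of_forall fun z => ?_)
    simp only [Function.comp, himage]
  have hmeasG (m : ℕ) : AEMeasurable
      (fun z : S × (Fin m → S) => G z.1 * g (insert z.1 (Finset.univ.image z.2)))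
      (μ.prod (Measure.pi fun _ => μ)) :=
    (hG.comp measurable_fst).aemeasurable.mul (hmeas m)
  -- Moving coordinate `j` to the front shows that the `m + 1` coordinates contribute equally. The
  -- resulting factor `m + 1` turns `1/(m+1)!` into `1/m!`.
  have hterm (m : ℕ) : ∫⁻ x : Fin (m + 1) → S, (∑ y ∈ Finset.univ.image x, G y) *
      g (Finset.univ.image x) ∂(Measure.pi fun _ => μ) =
      (m + 1 : ℕ) * ∫⁻ y, G y * ∫⁻ x : Fin m → S, g (insert y (Finset.univ.image x))
        ∂(Measure.pi fun _ => μ) ∂μ := by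
    calc _ = ∫⁻ x : Fin (m + 1) → S, ∑ j, G (x j) * g (Finset.univ.image x)
          ∂(Measure.pi fun _ => μ) := by
          refine lintegral_congr_ae ?_
          filter_upwards [ae_pi_injective (m + 1)] with x hx
          rw [Finset.sum_image hx.injOn, Finset.sum_mul]
      _ = ∑ j : Fin (m + 1), ∫⁻ x : Fin (m + 1) → S, G (x j) * g (Finset.univ.image x)
          ∂(Measure.pi fun _ => μ) :=
          lintegral_finsetSum' _ fun j _ =>
            (hG.comp (measurable_pi_apply j)).aemeasurable.mul (hg (m + 1))
      _ = ∑ j : Fin (m + 1), ∫⁻ y, G y * ∫⁻ x : Fin m → S, g (insert y (Finset.univ.image x))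
          ∂(Measure.pi fun _ => μ) ∂μ := by
          refine Finset.sum_congr rfl fun j _ => ?_
          rw [← ((measurePreserving_piFinSuccAbove (fun _ : Fin (m + 1) => μ)
            j).symm).lintegral_comp_emb (MeasurableEquiv.measurableEmbedding _)]
          simp only [himage]
          have : ∀ z : S × (Fin m → S),
              ((MeasurableEquiv.piFinSuccAbove (fun _ : Fin (m + 1) => S) j).symm z) j = z.1 := by
            intro z
            simp [MeasurableEquiv.piFinSuccAbove_symm_apply, Fin.insertNthEquiv]
          simp only [this]
          rw [lintegral_prod _ (hmeasG m)]
          refine lintegral_congr_ae ?_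
          -- The integrand is only a.e. measurable on the product; for almost every `y` its section
          -- agrees a.e. with the section of a measurable version.
          filter_upwards [Measure.ae_ae_of_ae_prod (hmeas m).ae_eq_mk] with y hy
          refine lintegral_const_mul'' _ ?_
          exact ⟨_, (hmeas m).measurable_mk.comp measurable_prodMk_left, hy⟩
      _ = _ := by simp
  have hint (m : ℕ) : AEMeasurable (fun y => ∫⁻ x : Fin m → S,
      g (insert y (Finset.univ.image x)) ∂(Measure.pi fun _ => μ)) μ :=
    (hmeas m).lintegral_prod_right'
  -- The term `m = 0` drops out because the sum over the empty set is zero.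
  have hsplit (F : ℕ → ℝ≥0∞) (h0 : F 0 = 0) : ∑' m, ((m ! : ℕ) : ℝ≥0∞)⁻¹ * F m =
      ∑' m, (((m + 1) ! : ℕ) : ℝ≥0∞)⁻¹ * F (m + 1) := by
    refine (tsum_eq_zero_add' (f := fun m => ((m ! : ℕ) : ℝ≥0∞)⁻¹ * F m)
      ENNReal.summable).trans ?_
    simp only [h0, mul_zero, zero_add]
  have hleft := hsplit (fun m => ∫⁻ x : Fin m → S, (∑ y ∈ Finset.univ.image x, G y) *
    g (Finset.univ.image x) ∂(Measure.pi fun _ => μ)) (by simp)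
  refine Eq.trans hleft ?_
  simp only [setLIntegral]
  simp only [hterm, ← ENNReal.tsum_mul_left]
  have hswap := lintegral_tsum (μ := μ) (f := fun m y => G y * (((m ! : ℕ) : ℝ≥0∞)⁻¹ *
    ∫⁻ x : Fin m → S, g (insert y (Finset.univ.image x)) ∂(Measure.pi fun _ => μ)))
    fun m => hG.aemeasurable.mul ((hint m).const_mul _)
  refine Eq.trans (tsum_congr fun m => ?_) hswap.symm
  rw [← mul_assoc, inv_factorial_succ_mul, ← lintegral_const_mul' _ _
    (ENNReal.inv_ne_top.2 (by exact_mod_cast m.factorial_ne_zero))]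
  exact lintegral_congr fun y => mul_left_comm _ _ _

end SetIntegral

/-! ### Signed set integrals as differences -/

section Signed

variable {S : Type*} [MeasurableSpace S] {μ : Measure S} [DecidableEq S]

/-- Pointwise `g⁻ ≤ v`: where `g ≤ 0` the hypothesis reads `v = u + g⁻`, and elsewhere `g⁻ = 0`. -/
theorem setLIntegral_neg_ne_top {g : Finset S → EReal} {u v : Finset S → ℝ≥0∞}
    (h : ∀ X, (g X).toENNReal + v X = u X + (-g X).toENNReal) (hv : setLIntegral μ v ≠ ∞) :
    setLIntegral μ (fun X => (-g X).toENNReal) ≠ ∞ := by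
  refine ne_top_of_le_ne_top hv (setLIntegral_mono fun X => ?_)
  rcases le_total (g X) 0 with hg | hg
  · have := h X
    rw [EReal.toENNReal_of_nonpos hg, zero_add] at this
    rw [this]
    exact le_add_self
  · rw [EReal.toENNReal_of_nonpos (by simpa using hg)]
    exact zero_le

/-- Integrate `g⁺ + v = u + g⁻`. Each side splits as soon as one of its summands is measurable, so
measurability of `g` itself is not needed. The integrals of `v` and `g⁻` are finite and can be moved
across. -/
theorem setIntegral_eq_sub {g : Finset S → EReal} {u v : Finset S → ℝ≥0∞}
    (hu : SetAEMeasurable μ u) (hvm : SetAEMeasurable μ v)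
    (h : ∀ X, (g X).toENNReal + v X = u X + (-g X).toENNReal) (hv : setLIntegral μ v ≠ ∞) :
    setIntegral μ g = (setLIntegral μ u : EReal) - (setLIntegral μ v : EReal) := by
  have hneg := setLIntegral_neg_ne_top h hv
  have hsum : setLIntegral μ (fun X => (g X).toENNReal) + setLIntegral μ v =
      setLIntegral μ u + setLIntegral μ (fun X => (-g X).toENNReal) := by
    rw [← setLIntegral_add_right hvm, ← setLIntegral_add_left hu]
    simp only [h]
  unfold setIntegral
  generalize setLIntegral μ (fun X => (g X).toENNReal) = a at *
  generalize setLIntegral μ (fun X => (-g X).toENNReal) = b at *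
  generalize setLIntegral μ u = c at *
  generalize setLIntegral μ v = e at *
  lift b to NNReal using hneg
  lift e to NNReal using hv
  induction a with
  | top =>
    have : c = ∞ := by
      by_contra hc
      rw [top_add] at hsum
      exact ENNReal.add_ne_top.2 ⟨hc, ENNReal.coe_ne_top⟩ hsum.symm
    subst this
    rfl
  | coe a =>
    have : c ≠ ∞ := by
      rintro rfl
      rw [top_add] at hsum
      exact ENNReal.add_ne_top.2 ⟨ENNReal.coe_ne_top, ENNReal.coe_ne_top⟩ hsum
    lift c to NNReal using this
    have h' : (a : ℝ) + e = c + b := by exact_mod_cast hsum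
    have h'' : (a : ℝ) - b = c - e := by linarith
    have hcoe (x : NNReal) : ((x : ℝ≥0∞) : EReal) = ((x : ℝ) : EReal) := rfl
    rw [hcoe, hcoe, hcoe, hcoe, ← EReal.coe_sub, ← EReal.coe_sub, h'']

end Signed

/-! ### Total masses of Poisson multi-Bernoulli densities -/

section Labelled

variable {n d : ℕ}

/-- Weight `α` of no element, `β` of one element, `0` of more. -/
def cardWeight (α β : ℝ≥0∞) (k : ℕ) : ℝ≥0∞ := if k = 0 then α else if k = 1 then β else 0

/-- The unnormalised density of a Poisson point process on track `0` and independent Bernoulli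
processes on the other tracks, `D` being the density of points. -/
def trackDensity (D : AugTarget n d → ℝ≥0∞) (α β : Fin n → ℝ≥0∞) (X : Finset (AugTarget n d)) :
    ℝ≥0∞ :=
  (∏ y ∈ X, D y) * ∏ i, cardWeight (α i) (β i) (track i.succ X).card

instance : SigmaFinite (augMeasure n d) := by unfold augMeasure; infer_instance

/-- This is where `d ≥ 1` enters: for `d = 0` points have positive mass and tuples with repetitions
are not negligible. -/
instance [NeZero d] : NullSingletonClass (augMeasure n d) := by
  unfold augMeasure; infer_instance

theorem card_track_image {m : ℕ} {x : Fin m → AugTarget n d} (hx : Function.Injective x)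
    (u : Fin (n + 1)) :
    (track u (Finset.univ.image x)).card = (Finset.univ.filter fun j => (x j).1 = u).card := by
  rw [track, Finset.filter_image, Finset.card_image_of_injective _ hx]

theorem track_insert_of_eq {y : AugTarget n d} {u : Fin (n + 1)} (h : y.1 = u)
    (X : Finset (AugTarget n d)) : track u (insert y X) = insert y (track u X) := by
  simp [track, Finset.filter_insert, h]

theorem track_insert_of_ne {y : AugTarget n d} {u : Fin (n + 1)} (h : y.1 ≠ u)
    (X : Finset (AugTarget n d)) : track u (insert y X) = track u X := by
  simp [track, Finset.filter_insert, h]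

theorem card_track_insert {y : AugTarget n d} {X : Finset (AugTarget n d)} (hy : y ∉ X) :
    (track y.1 (insert y X)).card = (track y.1 X).card + 1 := by
  rw [track_insert_of_eq rfl, Finset.card_insert_of_notMem (by simp [track, hy])]

/-- One more point shifts the weights `(α, β)` to `(β, 0)`. Inserting a point thus only changes the
parameters of `trackDensity`, and Campbell's formula does not leave this family. -/
theorem cardWeight_succ (α β : ℝ≥0∞) (k : ℕ) : cardWeight α β (k + 1) = cardWeight β 0 k := by
  rcases k with _ | k <;> simp [cardWeight]

theorem trackDensity_insert_zero {D : AugTarget n d → ℝ≥0∞} {α β : Fin n → ℝ≥0∞}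
    {y : AugTarget n d} {X : Finset (AugTarget n d)} (hy : y ∉ X) (h : y.1 = 0) :
    trackDensity D α β (insert y X) = D y * trackDensity D α β X := by
  unfold trackDensity
  rw [Finset.prod_insert hy, mul_assoc]
  congr 2
  refine Finset.prod_congr rfl fun i _ => ?_
  rw [track_insert_of_ne (h ▸ (Fin.succ_ne_zero i).symm)]

theorem trackDensity_insert_succ {D : AugTarget n d → ℝ≥0∞} {α β : Fin n → ℝ≥0∞}
    {y : AugTarget n d} {X : Finset (AugTarget n d)} (hy : y ∉ X) {i : Fin n} (h : y.1 = i.succ) :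
    trackDensity D α β (insert y X) =
      D y * trackDensity D (Function.update α i (β i)) (Function.update β i 0) X := by
  unfold trackDensity
  rw [Finset.prod_insert hy, mul_assoc]
  congr 2
  refine Finset.prod_congr rfl fun j _ => ?_
  by_cases hj : j = i
  · subst hj
    rw [← h, card_track_insert hy, cardWeight_succ]
    simp
  · rw [track_insert_of_ne (by rw [h]; exact fun h' => hj (Fin.succ_injective _ h').symm)]
    simp [hj]

theorem lintegral_augMeasure {G : AugTarget n d → ℝ≥0∞} (hG : Measurable G) :
    ∫⁻ y, G y ∂(augMeasure n d) = ∑ u, ∫⁻ x, G (u, x) := by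
  rw [augMeasure, lintegral_prod _ hG.aemeasurable, lintegral_count, tsum_fintype]

theorem cardWeight_add (α β : ℝ≥0∞) (k : ℕ) :
    cardWeight α β k = cardWeight α 0 k + cardWeight 0 β k := by
  unfold cardWeight
  split_ifs <;> simp

theorem cardWeight_zero_left (β : ℝ≥0∞) (k : ℕ) : cardWeight 0 β k = k * cardWeight 0 β k := by
  unfold cardWeight
  split_ifs with h h <;> simp [h]

theorem prod_cardWeight_split (α β : Fin n → ℝ≥0∞) (i : Fin n) (k : Fin n → ℕ) :
    ∏ j, cardWeight (α j) (β j) (k j) =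
      ∏ j, cardWeight (α j) (Function.update β i 0 j) (k j) +
        ∏ j, cardWeight (Function.update α i 0 j) (β j) (k j) := by
  simp only [← Finset.mul_prod_erase Finset.univ _ (Finset.mem_univ i), Function.update_self]
  rw [cardWeight_add, add_mul]
  congr 2 <;>
  · refine Finset.prod_congr rfl fun j hj => ?_
    rw [Function.update_of_ne (Finset.ne_of_mem_erase hj)]

theorem trackDensity_split (D : AugTarget n d → ℝ≥0∞) (α β : Fin n → ℝ≥0∞) (i : Fin n)
    (X : Finset (AugTarget n d)) :
    trackDensity D α β X = trackDensity D α (Function.update β i 0) X +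
      trackDensity D (Function.update α i 0) β X := by
  unfold trackDensity
  rw [prod_cardWeight_split α β i, mul_add]

/-- With `α i = 0` only sets with exactly one point on track `i` have positive density, so the
number of these points can be inserted as a factor. This puts the density in the form to which
Campbell's formula applies. -/
theorem trackDensity_update_zero (D : AugTarget n d → ℝ≥0∞) (α β : Fin n → ℝ≥0∞) (i : Fin n)
    (X : Finset (AugTarget n d)) :
    trackDensity D (Function.update α i 0) β X =
      (∑ y ∈ X, if y.1 = i.succ then 1 else 0) * trackDensity D (Function.update α i 0) β X := by
  have hsum : (∑ y ∈ X, if y.1 = i.succ then (1 : ℝ≥0∞) else 0) = (track i.succ X).card := by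
    rw [track, Finset.sum_ite, Finset.sum_const_zero, add_zero, Finset.sum_const, nsmul_one]
  rw [hsum]
  unfold trackDensity
  rw [mul_left_comm]
  congr 1
  rw [← Finset.mul_prod_erase Finset.univ _ (Finset.mem_univ i), Function.update_self,
    ← mul_assoc, ← cardWeight_zero_left]

variable [NeZero d]

theorem setAEMeasurable_comp_card_track (c : (Fin n → ℕ) → ℝ≥0∞) :
    SetAEMeasurable (augMeasure n d) fun X => c fun i => (track i.succ X).card := by
  intro m
  refine AEMeasurable.congr (f := (fun u : Fin m → Fin (n + 1) =>
    c fun i => (Finset.univ.filter fun j => u j = i.succ).card) ∘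
      fun x : Fin m → AugTarget n d => fun j => (x j).1) ?_ ?_
  · exact (Measurable.of_discrete.comp (by fun_prop)).aemeasurable
  · filter_upwards [ae_pi_injective m] with x hx
    simp only [Function.comp, card_track_image hx]

theorem setAEMeasurable_prod_mem {D : AugTarget n d → ℝ≥0∞} (hD : Measurable D) :
    SetAEMeasurable (augMeasure n d) fun X => ∏ y ∈ X, D y := by
  intro m
  refine AEMeasurable.congr (f := fun x : Fin m → AugTarget n d => ∏ j, D (x j))
    (Finset.measurable_fun_prod _ fun j _ => hD.comp (measurable_pi_apply j)).aemeasurable ?_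
  filter_upwards [ae_pi_injective m] with x hx
  rw [Finset.prod_image hx.injOn]

theorem setAEMeasurable_trackDensity {D : AugTarget n d → ℝ≥0∞} (hD : Measurable D)
    (α β : Fin n → ℝ≥0∞) : SetAEMeasurable (augMeasure n d) (trackDensity D α β) :=
  (setAEMeasurable_prod_mem hD).mul (setAEMeasurable_comp_card_track
    fun k => ∏ i, cardWeight (α i) (β i) (k i))

theorem setLIntegral_congr_insert {y : AugTarget n d} {g h : Finset (AugTarget n d) → ℝ≥0∞}
    (hgh : ∀ X, y ∉ X → g (insert y X) = h X) :
    setLIntegral (augMeasure n d) (fun X => g (insert y X)) = setLIntegral (augMeasure n d) h := by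
  unfold setLIntegral
  refine tsum_congr fun m => ?_
  congr 1
  refine lintegral_congr_ae ?_
  filter_upwards [ae_pi_forall_ne m y] with x hx
  exact hgh _ (by simpa using hx)

/-- Campbell's formula for points on track `i`. -/
theorem setLIntegral_sum_mem_mul_trackDensity {D G : AugTarget n d → ℝ≥0∞} (hD : Measurable D)
    (hG : Measurable G) (α β : Fin n → ℝ≥0∞) :
    setLIntegral (augMeasure n d) (fun X => (∑ y ∈ X, G y) * trackDensity D α β X) =
      (∫⁻ x, D (0, x) * G (0, x)) * setLIntegral (augMeasure n d) (trackDensity D α β) +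
      ∑ i : Fin n, (∫⁻ x, D (i.succ, x) * G (i.succ, x)) * setLIntegral (augMeasure n d)
        (trackDensity D (Function.update α i (β i)) (Function.update β i 0)) := by
  rw [setLIntegral_sum_mem_mul hG (setAEMeasurable_trackDensity hD α β)]
  let M : Fin (n + 1) → ℝ≥0∞ := Fin.cases (setLIntegral (augMeasure n d) (trackDensity D α β))
    fun i => setLIntegral (augMeasure n d)
      (trackDensity D (Function.update α i (β i)) (Function.update β i 0))
  have hM (y : AugTarget n d) :
      setLIntegral (augMeasure n d) (fun X => trackDensity D α β (insert y X)) =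
        D y * M y.1 := by
    obtain ⟨u, x⟩ := y
    induction u using Fin.cases with
    | zero =>
      rw [setLIntegral_congr_insert fun X hX => trackDensity_insert_zero hX rfl,
        setLIntegral_const_mul (setAEMeasurable_trackDensity hD _ _)]
      rfl
    | succ i =>
      rw [setLIntegral_congr_insert fun X hX => trackDensity_insert_succ hX rfl,
        setLIntegral_const_mul (setAEMeasurable_trackDensity hD _ _)]
      rfl
  simp only [hM]
  have hMm : Measurable fun y : AugTarget n d => M y.1 :=
    (Measurable.of_discrete (f := M)).comp measurable_fst
  have hmeas : Measurable fun y : AugTarget n d => G y * (D y * M y.1) := hG.mul (hD.mul hMm)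
  rw [lintegral_augMeasure hmeas, Fin.sum_univ_succ]
  have hterm (u : Fin (n + 1)) : ∫⁻ x, G (u, x) * (D (u, x) * M u) =
      (∫⁻ x, D (u, x) * G (u, x)) * M u := by
    have hm : Measurable fun x : Fin d → ℝ => D (u, x) * G (u, x) :=
      (hD.comp measurable_prodMk_left).mul (hG.comp measurable_prodMk_left)
    rw [← lintegral_mul_const _ hm]
    refine lintegral_congr fun x => ?_
    ring
  simp only [hterm]
  rfl

theorem tsum_pow_div_factorial {t : ℝ} (ht : 0 ≤ t) :
    ∑' m : ℕ, ((m ! : ℕ) : ℝ≥0∞)⁻¹ * ENNReal.ofReal t ^ m = ENNReal.ofReal (Real.exp t) := by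
  have h := NormedSpace.expSeries_div_hasSum_exp t
  rw [← Real.exp_eq_exp_ℝ] at h
  rw [← h.tsum_eq, ENNReal.ofReal_tsum_of_nonneg (fun m => by positivity) h.summable]
  refine tsum_congr fun m => ?_
  rw [ENNReal.ofReal_div_of_pos (by positivity), ENNReal.ofReal_pow ht, ENNReal.ofReal_natCast,
    div_eq_mul_inv, mul_comm]

/-- With `β = 0` any point outside track `0` makes the density vanish. What is left is a Poisson
process on track `0`, whose mass is the exponential series. -/
theorem setLIntegral_trackDensity_zero {D : AugTarget n d → ℝ≥0∞} (hD : Measurable D)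
    {t : ℝ} (ht : 0 ≤ t) (hDt : ∫⁻ x, D (0, x) = ENNReal.ofReal t) (α : Fin n → ℝ≥0∞) :
    setLIntegral (augMeasure n d) (trackDensity D α 0) =
      ENNReal.ofReal (Real.exp t) * ∏ i, α i := by
  let D₀ : AugTarget n d → ℝ≥0∞ := fun y => if y.1 = 0 then D y else 0
  have hD₀ : Measurable D₀ :=
    Measurable.ite (measurable_fst (measurableSet_singleton 0)) hD measurable_const
  have h (X : Finset (AugTarget n d)) : trackDensity D α 0 X = (∏ i, α i) * ∏ y ∈ X, D₀ y := by
    unfold trackDensity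
    by_cases hX : ∀ y ∈ X, y.1 = 0
    · rw [mul_comm]
      congr 1
      · refine Finset.prod_congr rfl fun i _ => ?_
        have : track i.succ X = ∅ := by
          refine Finset.filter_eq_empty_iff.2 fun y hy => ?_
          rw [hX y hy]
          exact (Fin.succ_ne_zero i).symm
        simp [this, cardWeight]
      · exact Finset.prod_congr rfl fun y hy => by simp [D₀, hX y hy]
    · push Not at hX
      obtain ⟨y, hy, hy0⟩ := hX
      rw [Finset.prod_eq_zero (i := y) (f := D₀) hy (by simp [D₀, hy0]), mul_zero]
      obtain ⟨i, hi⟩ := Fin.exists_succ_eq.2 hy0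
      rw [Finset.prod_eq_zero (i := i) (Finset.mem_univ _), mul_zero]
      have : (track i.succ X).card ≠ 0 :=
        Finset.card_ne_zero_of_mem (a := y) (by simp [track, hy, hi])
      simp [cardWeight, this]
  have hint : ∫⁻ y, D₀ y ∂(augMeasure n d) = ENNReal.ofReal t := by
    rw [lintegral_augMeasure hD₀, Fin.sum_univ_succ]
    simp [D₀, hDt, Fin.succ_ne_zero]
  simp only [funext h]
  rw [setLIntegral_const_mul (setAEMeasurable_prod_mem hD₀), mul_comm]
  congr 1
  rw [← tsum_pow_div_factorial ht, setLIntegral]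
  refine tsum_congr fun m => ?_
  congr 1
  rw [← hint, ← lintegral_pi_prod_eq_pow hD₀]
  refine lintegral_congr_ae ?_
  filter_upwards [ae_pi_injective m] with x hx
  rw [Finset.prod_image hx.injOn]

/-- Induction on a set of tracks outside which `β` vanishes. The density is split according to
whether track `i` carries no point or one; Campbell's formula turns the second part into `∫ D` on
track `i` times a mass with `β i = 0`, so both parts fall under the induction hypothesis. -/
theorem setLIntegral_trackDensity {D : AugTarget n d → ℝ≥0∞} (hD : Measurable D)
    {t : ℝ} (ht : 0 ≤ t) (hDt : ∫⁻ x, D (0, x) = ENNReal.ofReal t) (α β : Fin n → ℝ≥0∞) :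
    setLIntegral (augMeasure n d) (trackDensity D α β) =
      ENNReal.ofReal (Real.exp t) * ∏ i, (α i + β i * ∫⁻ x, D (i.succ, x)) := by
  suffices H : ∀ (s : Finset (Fin n)) (α β : Fin n → ℝ≥0∞), (∀ i ∉ s, β i = 0) →
      setLIntegral (augMeasure n d) (trackDensity D α β) =
      ENNReal.ofReal (Real.exp t) * ∏ i, (α i + β i * ∫⁻ x, D (i.succ, x)) from
    H Finset.univ α β (by simp)
  intro s
  induction s using Finset.induction_on with
  | empty =>
    intro α β hβ
    obtain rfl : β = 0 := funext fun i => hβ i (by simp)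
    rw [setLIntegral_trackDensity_zero hD ht hDt]
    simp
  | insert i s hi ih =>
    intro α β hβ
    have hupd : ∀ j ∉ s, Function.update β i 0 j = 0 := fun j hj => by
      by_cases hji : j = i
      · simp [hji]
      · rw [Function.update_of_ne hji]
        exact hβ j (by simp [hji, hj])
    have hG : Measurable fun y : AugTarget n d => if y.1 = i.succ then (1 : ℝ≥0∞) else 0 :=
      Measurable.ite (measurable_fst (measurableSet_singleton _)) measurable_const measurable_const
    have h2 : setLIntegral (augMeasure n d) (trackDensity D (Function.update α i 0) β) =
        (∫⁻ x, D (i.succ, x)) * setLIntegral (augMeasure n d)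
          (trackDensity D (Function.update α i (β i)) (Function.update β i 0)) := by
      rw [funext (trackDensity_update_zero D α β i), setLIntegral_sum_mem_mul_trackDensity hD hG,
        Finset.sum_eq_single i]
      · simp [(Fin.succ_ne_zero i).symm]
      · intro j _ hj
        simp [hj]
      · simp
    rw [funext (trackDensity_split D α β i),
      setLIntegral_add_left (setAEMeasurable_trackDensity hD _ _), h2, ih _ _ hupd, ih _ _ hupd]
    simp only [← Finset.mul_prod_erase Finset.univ _ (Finset.mem_univ i), Function.update_self]
    have hβ' : ∏ j ∈ Finset.univ.erase i, (α j + Function.update β i 0 j * ∫⁻ x, D (j.succ, x)) =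
        ∏ j ∈ Finset.univ.erase i, (α j + β j * ∫⁻ x, D (j.succ, x)) :=
      Finset.prod_congr rfl fun j hj => by
        rw [Function.update_of_ne (Finset.ne_of_mem_erase hj)]
    have hα' : ∏ j ∈ Finset.univ.erase i, (Function.update α i (β i) j +
        Function.update β i 0 j * ∫⁻ x, D (j.succ, x)) =
        ∏ j ∈ Finset.univ.erase i, (α j + β j * ∫⁻ x, D (j.succ, x)) :=
      Finset.prod_congr rfl fun j hj => by
        rw [Function.update_of_ne (Finset.ne_of_mem_erase hj),
          Function.update_of_ne (Finset.ne_of_mem_erase hj)]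
    rw [hβ', hα']
    ring

end Labelled

/-! ### Positive and negative parts of logarithms of ratios -/

section LogRatio

/-- The positive part of `log (s / t)`, with value `∞` for `t = 0` unless `s = 0`. -/
def logRatioPos (s t : ℝ) : ℝ≥0∞ := if s ≠ 0 ∧ t = 0 then ∞ else ENNReal.ofReal (Real.log (s / t))

/-- The negative part of `log (s / t)`, with value `0` if `s = 0` or `t = 0`. -/
def logRatioNeg (s t : ℝ) : ℝ≥0∞ := ENNReal.ofReal (-Real.log (s / t))

theorem logRatioNeg_ne_top (s t : ℝ) : logRatioNeg s t ≠ ∞ := ENNReal.ofReal_ne_top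

theorem logRatioPos_self (s : ℝ) : logRatioPos s s = 0 := by
  by_cases h : s = 0 <;> simp [logRatioPos, h]

theorem logRatioNeg_self (s : ℝ) : logRatioNeg s s = 0 := by
  by_cases h : s = 0 <;> simp [logRatioNeg, h]

theorem measurable_logRatioPos : Measurable fun z : ℝ × ℝ => logRatioPos z.1 z.2 := by
  unfold logRatioPos
  refine Measurable.ite ?_ measurable_const (by fun_prop)
  exact (measurable_fst (measurableSet_singleton (0 : ℝ)).compl).inter
    (measurable_snd (measurableSet_singleton 0))

theorem measurable_logRatioNeg : Measurable fun z : ℝ × ℝ => logRatioNeg z.1 z.2 := by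
  unfold logRatioNeg
  fun_prop

theorem toENNReal_kldIntegrand {s : ℝ} (hs : 0 ≤ s) (t : ℝ) :
    (kldIntegrand s t).toENNReal = ENNReal.ofReal s * logRatioPos s t := by
  unfold kldIntegrand logRatioPos
  by_cases h : s = 0
  · simp [h]
  by_cases ht : t = 0
  · simp [h, ht, ENNReal.mul_top, lt_of_le_of_ne hs (Ne.symm h)]
  · rw [if_neg h, if_neg ht, if_neg (by simp [ht]), ← ENNReal.ofReal_mul hs]
    rw [EReal.toENNReal_of_ne_top (EReal.coe_ne_top _), EReal.toReal_coe]

theorem toENNReal_neg_kldIntegrand {s : ℝ} (hs : 0 ≤ s) (t : ℝ) :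
    (-kldIntegrand s t).toENNReal = ENNReal.ofReal s * logRatioNeg s t := by
  unfold kldIntegrand logRatioNeg
  by_cases h : s = 0
  · simp [h]
  by_cases ht : t = 0
  · simp [h, ht]
  · rw [if_neg h, if_neg ht, ← ENNReal.ofReal_mul hs, ← EReal.coe_neg,
      EReal.toENNReal_of_ne_top (EReal.coe_ne_top _), EReal.toReal_coe, mul_neg]

/-- `log (s / t) = u - v`, without subtraction. -/
def IsLogRatio (s t : ℝ) (u v : ℝ≥0∞) : Prop := logRatioPos s t + v = u + logRatioNeg s t

theorem isLogRatio_self (s t : ℝ) : IsLogRatio s t (logRatioPos s t) (logRatioNeg s t) := rfl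

theorem IsLogRatio.top {s : ℝ} {u v : ℝ≥0∞} (hs : s ≠ 0) (h : IsLogRatio s 0 u v) : u = ∞ := by
  simpa [IsLogRatio, logRatioPos, logRatioNeg, hs, eq_comm] using h

/-- Additivity of the logarithm. A vanishing denominator makes both sides of the required identity
infinite; otherwise all positive and negative parts are finite and can be cancelled. -/
theorem IsLogRatio.mul {s s' t t' : ℝ} {u u' v v' : ℝ≥0∞} (hs : s ≠ 0) (hs' : s' ≠ 0)
    (h : IsLogRatio s t u v) (h' : IsLogRatio s' t' u' v') :
    IsLogRatio (s * s') (t * t') (u + u') (v + v') := by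
  by_cases ht : t = 0
  · subst ht
    simp [IsLogRatio, logRatioPos, h.top hs, hs, hs']
  by_cases ht' : t' = 0
  · subst ht'
    simp [IsLogRatio, logRatioPos, h'.top hs', hs, hs']
  have hlog : Real.log (s * s' / (t * t')) = Real.log (s / t) + Real.log (s' / t') := by
    rw [mul_div_mul_comm, Real.log_mul (div_ne_zero hs ht) (div_ne_zero hs' ht')]
  unfold IsLogRatio logRatioPos logRatioNeg at *
  rw [if_neg (by simp [ht])] at h
  rw [if_neg (by simp [ht'])] at h'
  rw [if_neg (by simp [ht, ht']), hlog]
  set x := Real.log (s / t)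
  set y := Real.log (s' / t')
  -- This is `x + y = (x + y)` with each number written as positive minus negative part and the
  -- negative parts moved across.
  have key : ENNReal.ofReal (x + y) + ENNReal.ofReal (-x) + ENNReal.ofReal (-y) =
      ENNReal.ofReal (-(x + y)) + ENNReal.ofReal x + ENNReal.ofReal y := by
    rw [← ENNReal.toReal_eq_toReal_iff' (by simp) (by simp)]
    rw [ENNReal.toReal_add (by simp) (by simp), ENNReal.toReal_add (by simp) (by simp),
      ENNReal.toReal_add (by simp) (by simp), ENNReal.toReal_add (by simp) (by simp)]
    simp only [ENNReal.toReal_ofReal']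
    have e1 := max_zero_sub_max_neg_zero_eq_self x
    have e2 := max_zero_sub_max_neg_zero_eq_self y
    have e3 := max_zero_sub_max_neg_zero_eq_self (x + y)
    linarith
  have hfin : ENNReal.ofReal x + ENNReal.ofReal y ≠ ∞ := by simp
  refine (ENNReal.add_left_inj hfin).1 ?_
  calc _ = ENNReal.ofReal (x + y) + (ENNReal.ofReal x + v) + (ENNReal.ofReal y + v') := by ring
    _ = (ENNReal.ofReal (x + y) + ENNReal.ofReal (-x) + ENNReal.ofReal (-y)) + (u + u') := by
      rw [h, h']; ring
    _ = _ := by rw [key]; ring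

theorem isLogRatio_prod {ι : Type*} (A : Finset ι) {s : ι → ℝ} (t : ι → ℝ)
    (hs : ∀ k ∈ A, s k ≠ 0) : IsLogRatio (∏ k ∈ A, s k) (∏ k ∈ A, t k)
      (∑ k ∈ A, logRatioPos (s k) (t k)) (∑ k ∈ A, logRatioNeg (s k) (t k)) := by
  classical
  induction A using Finset.induction_on with
  | empty => simp [IsLogRatio, logRatioPos_self, logRatioNeg_self]
  | insert k A hk ih =>
    simp only [Finset.prod_insert hk, Finset.sum_insert hk]
    exact (isLogRatio_self _ _).mul (hs k (by simp))
      (Finset.prod_ne_zero_iff.2 fun j hj => hs j (by simp [hj]))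
      (ih fun j hj => hs j (by simp [hj]))

/-- From `log z ≤ z - 1` one gets `s log (t/s) ≤ t - s ≤ t`. Through this bound the negative part of
the divergence is always finite. -/
theorem ofReal_mul_logRatioNeg_le {s t : ℝ} (hs : 0 ≤ s) (ht : 0 ≤ t) :
    ENNReal.ofReal s * logRatioNeg s t ≤ ENNReal.ofReal t := by
  rcases hs.eq_or_lt with rfl | hs
  · simp
  rcases ht.eq_or_lt with rfl | ht
  · simp [logRatioNeg]
  rw [logRatioNeg, ← ENNReal.ofReal_mul hs.le, ← Real.log_inv, inv_div]
  refine ENNReal.ofReal_le_ofReal ?_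
  have := mul_le_mul_of_nonneg_left (Real.log_le_sub_one_of_pos (div_pos ht hs)) hs.le
  rw [mul_sub, mul_div_cancel₀ _ hs.ne'] at this
  linarith

end LogRatio

/-! ### Product form of the densities and expectations of additive functions -/

section Density

variable {n d : ℕ}

theorem BernoulliParam.integrable (b : BernoulliParam d) : Integrable b.p := by
  by_contra h
  have := b.p_integral
  rw [integral_undef h] at this
  exact zero_ne_one this

theorem BernoulliParam.lintegral_ofReal (b : BernoulliParam d) :
    ∫⁻ x, ENNReal.ofReal (b.p x) = 1 := by
  rw [← ofReal_integral_eq_lintegral_ofReal b.integrable (Filter.Eventually.of_forall b.p_nonneg),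
    b.p_integral, ENNReal.ofReal_one]

/-- The density of points of a Poisson multi-Bernoulli process with track indices. -/
def pointDensity (lam : PPPIntensity d) (b : Fin n → BernoulliParam d) (y : AugTarget n d) : ℝ :=
  Fin.cases (motive := fun _ => ℝ) (lam.val y.2) (fun i => (b i).r * (b i).p y.2) y.1

theorem pointDensity_nonneg (lam : PPPIntensity d) (b : Fin n → BernoulliParam d)
    (y : AugTarget n d) : 0 ≤ pointDensity lam b y := by
  obtain ⟨u, x⟩ := y
  induction u using Fin.cases with
  | zero => exact lam.nonneg x
  | succ i => exact mul_nonneg (b i).r_nonneg ((b i).p_nonneg x)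

theorem measurable_pointDensity (lam : PPPIntensity d) (b : Fin n → BernoulliParam d) :
    Measurable (pointDensity lam b) := by
  refine measurable_from_prod_countable_right fun u => ?_
  induction u using Fin.cases with
  | zero => exact lam.measurable
  | succ i => exact (b i).p_measurable.const_mul _

/-- The weight of the number `k` of points of a Bernoulli process. -/
def bernoulliWeight (r : ℝ) (k : ℕ) : ℝ := if k = 0 then 1 - r else if k = 1 then 1 else 0

/-- A Poisson multi-Bernoulli density with total mass `w` on sets of targets with track indices. -/
def pmbDensity (w : ℝ) (lam : PPPIntensity d) (b : Fin n → BernoulliParam d)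
    (X : Finset (AugTarget n d)) : ℝ :=
  w * Real.exp (-∫ x, lam.val x) *
    ((∏ y ∈ X, pointDensity lam b y) * ∏ i, bernoulliWeight (b i).r (track i.succ X).card)

/-- Each point lies on exactly one track, so a product over all points is a product over tracks. The
factor `r p(x)` of a Bernoulli density is attributed to its point, which leaves weight `1` for a
singleton and `1 - r` for the empty set. -/
theorem augPPP_mul_prod_augBernoulli (lam : PPPIntensity d) (b : Fin n → BernoulliParam d)
    (X : Finset (AugTarget n d)) :
    augPPP n lam (track 0 X) * ∏ i, augBernoulli i (b i) (track i.succ X) =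
      Real.exp (-∫ x, lam.val x) *
        ((∏ y ∈ X, pointDensity lam b y) * ∏ i, bernoulliWeight (b i).r (track i.succ X).card) := by
  have h0 : augPPP n lam (track 0 X) =
      Real.exp (-∫ x, lam.val x) * ∏ y ∈ track 0 X, pointDensity lam b y := by
    unfold augPPP
    congr 1
    refine Finset.prod_congr rfl fun y hy => ?_
    have hy0 : y.1 = 0 := (Finset.mem_filter.1 hy).2
    obtain ⟨u, x⟩ := y
    obtain rfl : u = 0 := hy0
    simp [pointDensity]
  have hs (i : Fin n) : augBernoulli i (b i) (track i.succ X) =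
      (∏ y ∈ track i.succ X, pointDensity lam b y) *
        bernoulliWeight (b i).r (track i.succ X).card := by
    unfold augBernoulli bernoulliWeight
    split_ifs with h1 h2
    · rw [Finset.card_eq_zero.1 h1, Finset.prod_empty, one_mul]
    · obtain ⟨y, hy⟩ := Finset.card_eq_one.1 h2
      have hyi : y.1 = i.succ := (Finset.mem_filter.1 (hy ▸ Finset.mem_singleton_self y :
        y ∈ track i.succ X)).2
      rw [hy, Finset.sum_singleton, Finset.prod_singleton]
      obtain ⟨u, x⟩ := y
      obtain rfl : u = i.succ := hyi
      simp [pointDensity]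
    · rw [mul_zero]
  have hprod : ∏ y ∈ X, pointDensity lam b y = (∏ y ∈ track 0 X, pointDensity lam b y) *
      ∏ i : Fin n, ∏ y ∈ track i.succ X, pointDensity lam b y := by
    rw [← Finset.prod_fiberwise X Prod.fst, Fin.prod_univ_succ]
    rfl
  rw [h0, hprod]
  simp only [hs, Finset.prod_mul_distrib]
  ring

theorem PMBM.augDensity_eq (f : PMBM d) (π : f.Permutations) (X : Finset (AugTarget f.n d))
    (a : f.A) : f.augDensity π X a = pmbDensity (f.w a) f.intensity (f.permBern π a) X := by
  rw [pmbDensity, mul_assoc, ← augPPP_mul_prod_augBernoulli, PMBM.augDensity]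
  ring

theorem PMB.augDensity_eq {f : PMBM d} (q : PMB f) (X : Finset (AugTarget f.n d)) (a : f.A) :
    q.augDensity X a = pmbDensity (q.w a) q.intensity q.bern X := by
  rw [pmbDensity, mul_assoc, ← augPPP_mul_prod_augBernoulli, PMB.augDensity]
  ring

theorem bernoulliWeight_nonneg {r : ℝ} (hr : r ≤ 1) (k : ℕ) : 0 ≤ bernoulliWeight r k := by
  unfold bernoulliWeight
  split_ifs <;> linarith

theorem ofReal_bernoulliWeight (r : ℝ) (k : ℕ) :
    ENNReal.ofReal (bernoulliWeight r k) = cardWeight (ENNReal.ofReal (1 - r)) 1 k := by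
  unfold bernoulliWeight cardWeight
  split_ifs <;> simp

theorem pmbDensity_nonneg {w : ℝ} (hw : 0 ≤ w) (lam : PPPIntensity d)
    (b : Fin n → BernoulliParam d) (X : Finset (AugTarget n d)) : 0 ≤ pmbDensity w lam b X :=
  mul_nonneg (mul_nonneg hw (Real.exp_pos _).le)
    (mul_nonneg (Finset.prod_nonneg fun y _ => pointDensity_nonneg lam b y)
      (Finset.prod_nonneg fun i _ => bernoulliWeight_nonneg (b i).r_le_one _))

theorem ofReal_pmbDensity {w : ℝ} (hw : 0 ≤ w) (lam : PPPIntensity d)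
    (b : Fin n → BernoulliParam d) (X : Finset (AugTarget n d)) :
    ENNReal.ofReal (pmbDensity w lam b X) =
      ENNReal.ofReal (w * Real.exp (-∫ x, lam.val x)) *
        trackDensity (fun y => ENNReal.ofReal (pointDensity lam b y))
          (fun i => ENNReal.ofReal (1 - (b i).r)) 1 X := by
  have hD : 0 ≤ ∏ y ∈ X, pointDensity lam b y :=
    Finset.prod_nonneg fun y _ => pointDensity_nonneg lam b y
  rw [pmbDensity, ENNReal.ofReal_mul (mul_nonneg hw (Real.exp_pos _).le), ENNReal.ofReal_mul hD,
    ENNReal.ofReal_prod_of_nonneg fun y _ => pointDensity_nonneg lam b y,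
    ENNReal.ofReal_prod_of_nonneg fun i _ => bernoulliWeight_nonneg (b i).r_le_one _]
  simp only [ofReal_bernoulliWeight]
  rfl

theorem lintegral_pointDensity_zero (lam : PPPIntensity d) (b : Fin n → BernoulliParam d) :
    ∫⁻ x, ENNReal.ofReal (pointDensity lam b (0, x)) = ENNReal.ofReal (∫ x, lam.val x) :=
  (ofReal_integral_eq_lintegral_ofReal lam.integrable
    (Filter.Eventually.of_forall lam.nonneg)).symm

theorem lintegral_pointDensity_succ (lam : PPPIntensity d) (b : Fin n → BernoulliParam d)
    (i : Fin n) :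
    ∫⁻ x, ENNReal.ofReal (pointDensity lam b (i.succ, x)) = ENNReal.ofReal (b i).r := by
  simp only [pointDensity, Fin.cases_succ, ENNReal.ofReal_mul (b i).r_nonneg]
  rw [lintegral_const_mul _ (b i).p_measurable.ennreal_ofReal, (b i).lintegral_ofReal, mul_one]

theorem trackDensity_mul_indicator (D : AugTarget n d → ℝ≥0∞) (α β : Fin n → ℝ≥0∞) (i : Fin n)
    (X : Finset (AugTarget n d)) :
    trackDensity D α β X * (if (track i.succ X).card = 0 then 1 else 0) =
      trackDensity D α (Function.update β i 0) X := by
  unfold trackDensity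
  rw [mul_assoc]
  congr 1
  simp only [← Finset.mul_prod_erase Finset.univ _ (Finset.mem_univ i), Function.update_self]
  rw [mul_right_comm]
  congr 1
  · unfold cardWeight
    split_ifs <;> simp
  · refine Finset.prod_congr rfl fun j hj => ?_
    rw [Function.update_of_ne (Finset.ne_of_mem_erase hj)]

variable [NeZero d]

theorem setAEMeasurable_ofReal_pmbDensity_mul {w : ℝ} (hw : 0 ≤ w) (lam : PPPIntensity d)
    (b : Fin n → BernoulliParam d) (c : ℝ≥0∞) {G : AugTarget n d → ℝ≥0∞} (hG : Measurable G)
    (κ : Fin n → ℝ≥0∞) :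
    SetAEMeasurable (augMeasure n d) fun X => ENNReal.ofReal (pmbDensity w lam b X) *
      (c + ∑ y ∈ X, G y + ∑ i, (if (track i.succ X).card = 0 then 1 else 0) * κ i) := by
  simp only [ofReal_pmbDensity hw]
  refine SetAEMeasurable.mul ((setAEMeasurable_trackDensity
    (measurable_pointDensity lam b).ennreal_ofReal _ _).const_mul _) (.add (.add ?_ ?_) ?_)
  · exact fun m => aemeasurable_const
  · exact setAEMeasurable_sum_mem hG
  · exact setAEMeasurable_comp_card_track fun k => ∑ i, (if k i = 0 then 1 else 0) * κ i

/-- Under a Poisson multi-Bernoulli density of mass `w`, the intensity of points is `pointDensity`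
itself and track `i` is empty with probability `1 - r`. Additive functions of this kind are exactly
those occurring in the logarithm of a ratio of two such densities. -/
theorem setLIntegral_pmbDensity_mul {w : ℝ} (hw : 0 ≤ w) (lam : PPPIntensity d)
    (b : Fin n → BernoulliParam d) (c : ℝ≥0∞) {G : AugTarget n d → ℝ≥0∞} (hG : Measurable G)
    (κ : Fin n → ℝ≥0∞) :
    setLIntegral (augMeasure n d) (fun X => ENNReal.ofReal (pmbDensity w lam b X) *
      (c + ∑ y ∈ X, G y + ∑ i, (if (track i.succ X).card = 0 then 1 else 0) * κ i)) =
    ENNReal.ofReal w * (c + ∑ u, (∫⁻ x, ENNReal.ofReal (pointDensity lam b (u, x)) * G (u, x)) +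
      ∑ i, ENNReal.ofReal (1 - (b i).r) * κ i) := by
  set D : AugTarget n d → ℝ≥0∞ := fun y => ENNReal.ofReal (pointDensity lam b y) with hDdef
  set α : Fin n → ℝ≥0∞ := fun i => ENNReal.ofReal (1 - (b i).r) with hα
  set K := ENNReal.ofReal (w * Real.exp (-∫ x, lam.val x)) with hK
  have hD : Measurable D := (measurable_pointDensity lam b).ennreal_ofReal
  have ht : 0 ≤ ∫ x, lam.val x := integral_nonneg lam.nonneg
  have hmass (α β : Fin n → ℝ≥0∞) := setLIntegral_trackDensity hD ht
    (lintegral_pointDensity_zero lam b) α β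
  have hKexp : K * ENNReal.ofReal (Real.exp (∫ x, lam.val x)) = ENNReal.ofReal w := by
    rw [hK, ← ENNReal.ofReal_mul (mul_nonneg hw (Real.exp_pos _).le), mul_assoc, ← Real.exp_add,
      neg_add_cancel, Real.exp_zero, mul_one]
  have hd (i : Fin n) : ∫⁻ x, D (i.succ, x) = ENNReal.ofReal (b i).r :=
    lintegral_pointDensity_succ lam b i
  have hone (i : Fin n) : α i + 1 * ∫⁻ x, D (i.succ, x) = 1 := by
    rw [hd, one_mul, hα, ← ENNReal.ofReal_add (sub_nonneg.2 (b i).r_le_one) (b i).r_nonneg,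
      sub_add_cancel, ENNReal.ofReal_one]
  have hM : K * setLIntegral (augMeasure n d) (trackDensity D α 1) = ENNReal.ofReal w := by
    rw [hmass, ← mul_assoc, hKexp, Finset.prod_eq_one, mul_one]
    exact fun i _ => hone i
  -- Once a point of track `i` is removed, this track has weights `(1, 0)`, and the mass of the rest
  -- is still `w`.
  have hMs (i : Fin n) : K * setLIntegral (augMeasure n d) (trackDensity D
      (Function.update α i ((1 : Fin n → ℝ≥0∞) i)) (Function.update 1 i 0)) = ENNReal.ofReal w := by
    rw [hmass, ← mul_assoc, hKexp, Finset.prod_eq_one, mul_one]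
    intro j _
    by_cases hj : j = i
    · subst hj; simp
    · rw [Function.update_of_ne hj, Function.update_of_ne hj]
      exact hone j
  -- Forbidding points on track `i` leaves only its factor `1 - r`.
  have hMe (i : Fin n) : K * setLIntegral (augMeasure n d) (trackDensity D α
      (Function.update 1 i 0)) = ENNReal.ofReal w * α i := by
    rw [hmass, ← mul_assoc, hKexp, Finset.prod_eq_single i]
    · simp
    · intro j _ hj
      rw [Function.update_of_ne hj]
      exact hone j
    · simp
  have hpt (X : Finset (AugTarget n d)) : ENNReal.ofReal (pmbDensity w lam b X) *
      (c + ∑ y ∈ X, G y + ∑ i, (if (track i.succ X).card = 0 then 1 else 0) * κ i) =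
      K * (c * trackDensity D α 1 X + (∑ y ∈ X, G y) * trackDensity D α 1 X +
        ∑ i, κ i * trackDensity D α (Function.update 1 i 0) X) := by
    rw [ofReal_pmbDensity hw]
    simp only [← trackDensity_mul_indicator]
    have : ∑ i, κ i * (trackDensity D α 1 X * (if (track i.succ X).card = 0 then 1 else 0)) =
        trackDensity D α 1 X * ∑ i, (if (track i.succ X).card = 0 then 1 else 0) * κ i := by
      rw [Finset.mul_sum]
      exact Finset.sum_congr rfl fun i _ => by ring
    rw [this]
    ring
  have hTm (α β : Fin n → ℝ≥0∞) := setAEMeasurable_trackDensity hD α β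
  have hGm := (setAEMeasurable_sum_mem (μ := augMeasure n d) hG).mul (hTm α 1)
  have hsm : SetAEMeasurable (augMeasure n d) fun X =>
      ∑ i, κ i * trackDensity D α (Function.update 1 i 0) X :=
    SetAEMeasurable.sum _ fun i => (hTm _ _).const_mul _
  simp only [hpt]
  rw [setLIntegral_const_mul ((((hTm α 1).const_mul c).add hGm).add hsm),
    setLIntegral_add_right hsm, setLIntegral_add_right hGm, setLIntegral_const_mul (hTm _ _),
    setLIntegral_sum _ fun i => (hTm _ _).const_mul _,
    setLIntegral_sum_mem_mul_trackDensity hD hG]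
  simp only [setLIntegral_const_mul (hTm _ _), mul_add, Finset.mul_sum, Fin.sum_univ_succ]
  have e1 (z : ℝ≥0∞) : K * (z * setLIntegral (augMeasure n d) (trackDensity D α 1)) =
      ENNReal.ofReal w * z := by rw [mul_left_comm, hM, mul_comm]
  have e2 (i : Fin n) (z : ℝ≥0∞) : K * (z * setLIntegral (augMeasure n d) (trackDensity D
      (Function.update α i ((1 : Fin n → ℝ≥0∞) i)) (Function.update 1 i 0))) =
      ENNReal.ofReal w * z := by rw [mul_left_comm, hMs, mul_comm]
  have e3 (i : Fin n) (z : ℝ≥0∞) : K * (z * setLIntegral (augMeasure n d) (trackDensity D α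
      (Function.update 1 i 0))) = ENNReal.ofReal w * (α i * z) := by
    rw [mul_left_comm, hMe, mul_comm, mul_assoc]
  simp only [e1, e2, e3]
  rfl

end Density

/-! ### The divergence as a difference of two integrals over factors -/

section Divergence

variable {n d : ℕ}

/-- A track with one point has weight `1` in both densities and one with more has weight `0` in
both, so only an empty track contributes. -/
theorem logRatioPos_bernoulliWeight (r r' : ℝ) (k : ℕ) :
    logRatioPos (bernoulliWeight r k) (bernoulliWeight r' k) =
      (if k = 0 then 1 else 0) * logRatioPos (1 - r) (1 - r') := by
  unfold bernoulliWeight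
  split_ifs <;> simp [logRatioPos_self]

theorem logRatioNeg_bernoulliWeight (r r' : ℝ) (k : ℕ) :
    logRatioNeg (bernoulliWeight r k) (bernoulliWeight r' k) =
      (if k = 0 then 1 else 0) * logRatioNeg (1 - r) (1 - r') := by
  unfold bernoulliWeight
  split_ifs <;> simp [logRatioNeg_self]

/-- The integral of the positive parts of the logarithms of the ratios of the factors of two
Poisson multi-Bernoulli densities. -/
def divergencePos (w w' : ℝ) (lam lam' : PPPIntensity d) (b b' : Fin n → BernoulliParam d) :
    ℝ≥0∞ :=
  ENNReal.ofReal w * (logRatioPos w w' +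
      logRatioPos (Real.exp (-∫ x, lam.val x)) (Real.exp (-∫ x, lam'.val x)) +
    ∑ u, (∫⁻ x, ENNReal.ofReal (pointDensity lam b (u, x)) *
      logRatioPos (pointDensity lam b (u, x)) (pointDensity lam' b' (u, x))) +
    ∑ i, ENNReal.ofReal (1 - (b i).r) * logRatioPos (1 - (b i).r) (1 - (b' i).r))

/-- The integral of the negative parts of the logarithms of the ratios of the factors of two
Poisson multi-Bernoulli densities. -/
def divergenceNeg (w w' : ℝ) (lam lam' : PPPIntensity d) (b b' : Fin n → BernoulliParam d) :
    ℝ≥0∞ :=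
  ENNReal.ofReal w * (logRatioNeg w w' +
      logRatioNeg (Real.exp (-∫ x, lam.val x)) (Real.exp (-∫ x, lam'.val x)) +
    ∑ u, (∫⁻ x, ENNReal.ofReal (pointDensity lam b (u, x)) *
      logRatioNeg (pointDensity lam b (u, x)) (pointDensity lam' b' (u, x))) +
    ∑ i, ENNReal.ofReal (1 - (b i).r) * logRatioNeg (1 - (b i).r) (1 - (b' i).r))

theorem lintegral_pointDensity_ne_top (lam : PPPIntensity d) (b : Fin n → BernoulliParam d)
    (u : Fin (n + 1)) : ∫⁻ x, ENNReal.ofReal (pointDensity lam b (u, x)) ≠ ∞ := by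
  induction u using Fin.cases with
  | zero => rw [lintegral_pointDensity_zero]; exact ENNReal.ofReal_ne_top
  | succ i => rw [lintegral_pointDensity_succ]; exact ENNReal.ofReal_ne_top

theorem divergenceNeg_ne_top (w w' : ℝ) (lam lam' : PPPIntensity d)
    (b b' : Fin n → BernoulliParam d) : divergenceNeg w w' lam lam' b b' ≠ ∞ := by
  refine ENNReal.mul_ne_top ENNReal.ofReal_ne_top ?_
  refine ENNReal.add_ne_top.2 ⟨ENNReal.add_ne_top.2 ⟨ENNReal.add_ne_top.2
    ⟨logRatioNeg_ne_top _ _, logRatioNeg_ne_top _ _⟩, ENNReal.sum_ne_top.2 fun u _ => ?_⟩,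
    ENNReal.sum_ne_top.2 fun i _ => ENNReal.mul_ne_top ENNReal.ofReal_ne_top
      (logRatioNeg_ne_top _ _)⟩
  exact ne_top_of_le_ne_top (lintegral_pointDensity_ne_top lam' b' u) (lintegral_mono fun x =>
    ofReal_mul_logRatioNeg_le (pointDensity_nonneg _ _ _) (pointDensity_nonneg _ _ _))

theorem isLogRatio_pmbDensity {w : ℝ} (w' : ℝ) {lam : PPPIntensity d} (lam' : PPPIntensity d)
    {b : Fin n → BernoulliParam d} (b' : Fin n → BernoulliParam d) {X : Finset (AugTarget n d)}
    (h : pmbDensity w lam b X ≠ 0) :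
    IsLogRatio (pmbDensity w lam b X) (pmbDensity w' lam' b' X)
      (logRatioPos w w' + logRatioPos (Real.exp (-∫ x, lam.val x)) (Real.exp (-∫ x, lam'.val x)) +
        (∑ y ∈ X, logRatioPos (pointDensity lam b y) (pointDensity lam' b' y) +
        ∑ i, (if (track i.succ X).card = 0 then 1 else 0) *
          logRatioPos (1 - (b i).r) (1 - (b' i).r)))
      (logRatioNeg w w' + logRatioNeg (Real.exp (-∫ x, lam.val x)) (Real.exp (-∫ x, lam'.val x)) +
        (∑ y ∈ X, logRatioNeg (pointDensity lam b y) (pointDensity lam' b' y) +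
        ∑ i, (if (track i.succ X).card = 0 then 1 else 0) *
          logRatioNeg (1 - (b i).r) (1 - (b' i).r))) := by
  simp only [← logRatioPos_bernoulliWeight, ← logRatioNeg_bernoulliWeight]
  unfold pmbDensity at *
  obtain ⟨h1, h2⟩ := mul_ne_zero_iff.1 h
  obtain ⟨h3, h4⟩ := mul_ne_zero_iff.1 h1
  obtain ⟨h5, h6⟩ := mul_ne_zero_iff.1 h2
  refine IsLogRatio.mul h1 h2 (.mul h3 h4 (isLogRatio_self _ _) (isLogRatio_self _ _))
    (.mul h5 h6 (isLogRatio_prod _ _ ?_) (isLogRatio_prod _ _ ?_))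
  · exact Finset.prod_ne_zero_iff.1 h5
  · exact Finset.prod_ne_zero_iff.1 h6

variable [NeZero d]

/-- Where the first density is nonzero, all its factors are, and `isLogRatio_pmbDensity` expresses
the logarithm through additive functions; elsewhere both sides are multiplied by zero. The
expectations are then those of `setLIntegral_pmbDensity_mul`. -/
theorem setIntegral_kldIntegrand_pmbDensity {w : ℝ} (hw : 0 ≤ w) (w' : ℝ)
    (lam lam' : PPPIntensity d) (b b' : Fin n → BernoulliParam d) :
    setIntegral (augMeasure n d)
        (fun X => kldIntegrand (pmbDensity w lam b X) (pmbDensity w' lam' b' X)) =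
      (divergencePos w w' lam lam' b b' : EReal) - (divergenceNeg w w' lam lam' b b' : EReal) := by
  have hm : Measurable fun y : AugTarget n d => (pointDensity lam b y, pointDensity lam' b' y) :=
    (measurable_pointDensity lam b).prodMk (measurable_pointDensity lam' b')
  have hG : Measurable fun y => logRatioPos (pointDensity lam b y) (pointDensity lam' b' y) :=
    measurable_logRatioPos.comp hm
  have hG' : Measurable fun y => logRatioNeg (pointDensity lam b y) (pointDensity lam' b' y) :=
    measurable_logRatioNeg.comp hm
  have hneg := setLIntegral_pmbDensity_mul hw lam b (logRatioNeg w w' +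
    logRatioNeg (Real.exp (-∫ x, lam.val x)) (Real.exp (-∫ x, lam'.val x))) hG'
    fun i => logRatioNeg (1 - (b i).r) (1 - (b' i).r)
  have hpos := setLIntegral_pmbDensity_mul hw lam b (logRatioPos w w' +
    logRatioPos (Real.exp (-∫ x, lam.val x)) (Real.exp (-∫ x, lam'.val x))) hG
    fun i => logRatioPos (1 - (b i).r) (1 - (b' i).r)
  rw [divergencePos, divergenceNeg, ← hpos, ← hneg]
  refine setIntegral_eq_sub (setAEMeasurable_ofReal_pmbDensity_mul hw lam b _ hG _)
    (setAEMeasurable_ofReal_pmbDensity_mul hw lam b _ hG' _) (fun X => ?_) ?_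
  · rw [toENNReal_kldIntegrand (pmbDensity_nonneg hw lam b X),
      toENNReal_neg_kldIntegrand (pmbDensity_nonneg hw lam b X), ← mul_add, ← mul_add]
    by_cases h : pmbDensity w lam b X = 0
    · simp [h]
    · congr 1
      rw [add_assoc _ (∑ y ∈ X, _), add_assoc _ (∑ y ∈ X, _)]
      exact isLogRatio_pmbDensity w' lam' b' h
  · rw [hneg]
    exact divergenceNeg_ne_top w w' lam lam' b b'

theorem kld_eq (f : PMBM d) (π : f.Permutations) (q : PMB f) :
    kld f π q = ∑ a : f.A,
      ((divergencePos (f.w a) (q.w a) f.intensity q.intensity (f.permBern π a) q.bern : EReal) -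
        (divergenceNeg (f.w a) (q.w a) f.intensity q.intensity (f.permBern π a) q.bern : EReal)) :=
    by
  unfold kld
  refine Finset.sum_congr rfl fun a _ => ?_
  rw [← setIntegral_kldIntegrand_pmbDensity (f.w_nonneg a)]
  simp only [PMBM.augDensity_eq, PMB.augDensity_eq]

end Divergence

/-! ### Moments of the standard Gaussian measure -/

section StandardGaussian

open ProbabilityTheory

variable {d : ℕ}

/-- The standard Gaussian measure on `ℝᵈ`. -/
def stdGaussianPi (d : ℕ) : Measure (Fin d → ℝ) := Measure.pi fun _ => gaussianReal 0 1

instance : IsProbabilityMeasure (stdGaussianPi d) := by unfold stdGaussianPi; infer_instance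

theorem stdGaussianPi_eq_withDensity :
    stdGaussianPi d = volume.withDensity fun z => ∏ i, gaussianPDF 0 1 (z i) := by
  refine Measure.pi_eq fun s hs => ?_
  have hg (i : Fin d) : Measurable ((s i).indicator (gaussianPDF 0 1)) :=
    (measurable_gaussianPDF 0 1).indicator (hs i)
  rw [withDensity_apply _ (MeasurableSet.univ_pi hs), ← lintegral_indicator
    (MeasurableSet.univ_pi hs)]
  have (z : Fin d → ℝ) : (Set.univ.pi s).indicator (fun z => ∏ i, gaussianPDF 0 1 (z i)) z =
      ∏ i, (s i).indicator (gaussianPDF 0 1) (z i) := by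
    by_cases hz : z ∈ Set.univ.pi s
    · rw [Set.indicator_of_mem hz]
      exact Finset.prod_congr rfl fun i _ => (Set.indicator_of_mem (hz i trivial) _).symm
    · rw [Set.indicator_of_notMem hz]
      simp only [Set.mem_pi, Set.mem_univ, true_implies, not_forall] at hz
      obtain ⟨i, hi⟩ := hz
      exact (Finset.prod_eq_zero (Finset.mem_univ i) (Set.indicator_of_notMem hi _)).symm
  simp only [this]
  rw [volume_pi, lintegral_pi_prod hg]
  refine Finset.prod_congr rfl fun i _ => ?_
  rw [lintegral_indicator (hs i), gaussianReal_apply 0 one_ne_zero]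

theorem memLp_eval_stdGaussianPi (i : Fin d) :
    MemLp (fun z : Fin d → ℝ => z i) 2 (stdGaussianPi d) :=
  (memLp_id_gaussianReal (μ := 0) (v := 1) 2).comp_measurePreserving
    (measurePreserving_eval (fun _ : Fin d => gaussianReal 0 1) i)

theorem integral_eval_stdGaussianPi (i : Fin d) : ∫ z, z i ∂(stdGaussianPi d) = 0 := by
  unfold stdGaussianPi
  rw [integral_comp_eval (μ := fun _ : Fin d => gaussianReal 0 1) (f := fun x => x)
    aestronglyMeasurable_id, integral_id_gaussianReal]

theorem integral_eval_mul_eval_stdGaussianPi (i j : Fin d) :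
    ∫ z, z i * z j ∂(stdGaussianPi d) = if i = j then 1 else 0 := by
  split_ifs with h
  · subst h
    unfold stdGaussianPi
    rw [integral_comp_eval (μ := fun _ : Fin d => gaussianReal 0 1) (i := i) (f := fun x => x * x)
      (by fun_prop)]
    have h1 := variance_eq_sub (memLp_id_gaussianReal (μ := 0) (v := 1) 2)
    rw [variance_id_gaussianReal] at h1
    simp only [id, integral_id_gaussianReal] at h1
    simpa [sq] using h1.symm
  · have hind := (iIndepFun_pi (μ := fun _ : Fin d => gaussianReal 0 1) (X := fun _ x => x)
      fun _ => aemeasurable_id).indepFun h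
    have := hind.integral_fun_mul_eq_mul_integral
      (measurable_pi_apply i).aestronglyMeasurable (measurable_pi_apply j).aestronglyMeasurable
    have h0 := integral_eval_stdGaussianPi i
    unfold stdGaussianPi at *
    rw [this, h0, zero_mul]

end StandardGaussian

/-! ### Gaussian densities, their moments and quadratic functions -/

section GaussianDensity

open ProbabilityTheory

variable {d : ℕ}

theorem gaussianDensity_pos (m : Fin d → ℝ) {C : Matrix (Fin d) (Fin d) ℝ} (hC : C.PosDef)
    (x : Fin d → ℝ) : 0 < gaussianDensity m C x := by
  have := hC.det_pos
  unfold gaussianDensity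
  positivity

theorem measurable_gaussianDensity (m : Fin d → ℝ) (C : Matrix (Fin d) (Fin d) ℝ) :
    Measurable (gaussianDensity m C) := by
  unfold gaussianDensity
  simp only [dotProduct, Matrix.mulVec]
  fun_prop

/-- In the coordinates `x = m + A z` the quadratic form becomes `∑ z i ^ 2`, and the square root of
`det (A Aᵀ)` is `|det A|`. -/
theorem gaussianDensity_affine (m : Fin d → ℝ) {A : Matrix (Fin d) (Fin d) ℝ} (hA : A.det ≠ 0)
    (z : Fin d → ℝ) : gaussianDensity m (A * Aᵀ) (m + A *ᵥ z) =
      |A.det|⁻¹ * ∏ i, gaussianPDFReal 0 1 (z i) := by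
  have hu : IsUnit A.det := isUnit_iff_ne_zero.2 hA
  have hinv : A *ᵥ z ⬝ᵥ ((A * Aᵀ)⁻¹ *ᵥ (A *ᵥ z)) = ∑ i, z i ^ 2 := by
    rw [Matrix.mul_inv_rev, Matrix.mulVec_mulVec, mul_assoc, Matrix.nonsing_inv_mul _ hu, mul_one,
      dotProduct_comm, Matrix.dotProduct_mulVec, Matrix.vecMul_mulVec]
    rw [← Matrix.transpose_nonsing_inv, Matrix.transpose_transpose, Matrix.nonsing_inv_mul _ hu,
      Matrix.vecMul_one]
    simp [dotProduct, sq]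
  have hsqrt : Real.sqrt ((2 * Real.pi) ^ d * (A * Aᵀ).det) =
      Real.sqrt (2 * Real.pi) ^ d * |A.det| := by
    rw [Matrix.det_mul, Matrix.det_transpose, Real.sqrt_mul (by positivity),
      Real.sqrt_mul_self_eq_abs]
    congr 1
    rw [Real.sqrt_eq_iff_mul_self_eq_of_pos (by positivity), ← mul_pow,
      Real.mul_self_sqrt (by positivity)]
  unfold gaussianDensity
  rw [add_sub_cancel_left, hinv, hsqrt]
  simp only [gaussianPDFReal, Finset.prod_mul_distrib, ← Real.exp_sum, sub_zero, NNReal.coe_one,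
    mul_one, Finset.prod_const, Finset.card_univ, Fintype.card_fin]
  rw [mul_inv, inv_pow, ← Finset.sum_div, Finset.sum_neg_distrib]
  ring

/-- The Gaussian measure with density `gaussianDensity m C`. -/
def gaussianMeasure (m : Fin d → ℝ) (C : Matrix (Fin d) (Fin d) ℝ) : Measure (Fin d → ℝ) :=
  volume.withDensity fun x => ENNReal.ofReal (gaussianDensity m C x)

theorem map_affine_volume (m : Fin d → ℝ) {A : Matrix (Fin d) (Fin d) ℝ} (hA : A.det ≠ 0) :
    Measure.map (fun z => m + A *ᵥ z) volume = ENNReal.ofReal |A.det|⁻¹ • volume := by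
  have h : (fun z => m + A *ᵥ z) = (fun x => m + x) ∘ Matrix.toLin' A := by
    ext z
    simp
  have hAm : Measurable (Matrix.toLin' A) := (LinearMap.continuous_on_pi _).measurable
  rw [h, ← Measure.map_map (measurable_const_add m) hAm,
    Real.map_matrix_volume_pi_eq_smul_volume_pi hA, Measure.map_smul,
    (measurePreserving_add_left volume m).map_eq, abs_inv]

theorem measurable_affine (m : Fin d → ℝ) (A : Matrix (Fin d) (Fin d) ℝ) :
    Measurable fun z => m + A *ᵥ z :=
  (continuous_const.add (Continuous.matrix_mulVec continuous_const continuous_id)).measurable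

theorem gaussianMeasure_mul_transpose (m : Fin d → ℝ) {A : Matrix (Fin d) (Fin d) ℝ}
    (hA : A.det ≠ 0) :
    gaussianMeasure m (A * Aᵀ) = (stdGaussianPi d).map fun z => m + A *ᵥ z := by
  have hT := measurable_affine m A
  have hgm : Measurable fun x => ENNReal.ofReal (gaussianDensity m (A * Aᵀ) x) :=
    (measurable_gaussianDensity _ _).ennreal_ofReal
  -- Written as a rescaled image of itself, Lebesgue measure can be pulled back along the affine
  -- map; the Jacobian `|det A|` then cancels the inverse factor in `gaussianDensity_affine`.
  have hvol : (volume : Measure (Fin d → ℝ)) =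
      ENNReal.ofReal |A.det| • Measure.map (fun z => m + A *ᵥ z) volume := by
    rw [map_affine_volume m hA, smul_smul, ← ENNReal.ofReal_mul (abs_nonneg _),
      mul_inv_cancel₀ (abs_ne_zero.2 hA), ENNReal.ofReal_one, one_smul]
  ext s hs
  have hsT : Measurable fun z => s.indicator
      (fun x => ENNReal.ofReal (gaussianDensity m (A * Aᵀ) x)) (m + A *ᵥ z) :=
    (hgm.indicator hs).comp hT
  rw [Measure.map_apply hT hs, stdGaussianPi_eq_withDensity, gaussianMeasure,
    withDensity_apply _ hs, withDensity_apply _ (hT hs), ← lintegral_indicator hs,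
    ← lintegral_indicator (hT hs)]
  nth_rewrite 1 [hvol]
  rw [lintegral_smul_measure, lintegral_map (hgm.indicator hs) hT, smul_eq_mul,
    ← lintegral_const_mul _ hsT]
  refine lintegral_congr fun z => ?_
  by_cases hz : m + A *ᵥ z ∈ s
  · rw [Set.indicator_of_mem hz, Set.indicator_of_mem (by exact hz), gaussianDensity_affine m hA,
      ENNReal.ofReal_mul (by positivity), ← mul_assoc, ← ENNReal.ofReal_mul (abs_nonneg _),
      mul_inv_cancel₀ (abs_ne_zero.2 hA), ENNReal.ofReal_one, one_mul,
      ENNReal.ofReal_prod_of_nonneg fun i _ => gaussianPDFReal_nonneg _ _ _]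
    rfl
  · rw [Set.indicator_of_notMem hz, Set.indicator_of_notMem (by exact hz), mul_zero]

/-- A positive definite matrix is strictly positive in the C⋆-algebra of matrices, hence of the form
`A * star A` with `A` invertible. All moments of Gaussian measures are thereby reduced to the
standard one. -/
theorem exists_gaussianMeasure_eq_map (m : Fin d → ℝ) {C : Matrix (Fin d) (Fin d) ℝ}
    (hC : C.PosDef) : ∃ A : Matrix (Fin d) (Fin d) ℝ, C = A * Aᵀ ∧
      gaussianMeasure m C = (stdGaussianPi d).map fun z => m + A *ᵥ z := by
  have h : ∃ A : Matrix (Fin d) (Fin d) ℝ, IsUnit A ∧ C = A * star A := by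
    open scoped MatrixOrder Matrix.Norms.L2Operator in
    exact CStarAlgebra.isStrictlyPositive_iff_eq_mul_star_self.mp hC.isStrictlyPositive
  obtain ⟨A, hA, rfl⟩ := h
  refine ⟨A, by simp [Matrix.star_eq_conjTranspose], ?_⟩
  have := gaussianMeasure_mul_transpose m (A := A)
    ((Matrix.isUnit_iff_isUnit_det A).1 hA).ne_zero
  simpa [Matrix.star_eq_conjTranspose] using this

theorem isProbabilityMeasure_gaussianMeasure (m : Fin d → ℝ) {C : Matrix (Fin d) (Fin d) ℝ}
    (hC : C.PosDef) : IsProbabilityMeasure (gaussianMeasure m C) := by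
  obtain ⟨A, -, h⟩ := exists_gaussianMeasure_eq_map m hC
  rw [h]
  exact Measure.isProbabilityMeasure_map (measurable_affine m A).aemeasurable

theorem memLp_eval_gaussianMeasure (m : Fin d → ℝ) {C : Matrix (Fin d) (Fin d) ℝ}
    (hC : C.PosDef) (i : Fin d) : MemLp (fun x : Fin d → ℝ => x i) 2 (gaussianMeasure m C) := by
  obtain ⟨A, -, h⟩ := exists_gaussianMeasure_eq_map m hC
  rw [h, memLp_map_measure_iff (measurable_pi_apply i).aestronglyMeasurable
    (measurable_affine m A).aemeasurable]
  have hs : MemLp (fun z : Fin d → ℝ => ∑ k, A i k * z k) 2 (stdGaussianPi d) :=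
    memLp_finsetSum _ fun k _ => (memLp_eval_stdGaussianPi k).const_mul (A i k)
  exact (memLp_const (m i)).add hs

theorem integral_eval_gaussianMeasure (m : Fin d → ℝ) {C : Matrix (Fin d) (Fin d) ℝ}
    (hC : C.PosDef) (i : Fin d) : ∫ x, x i ∂(gaussianMeasure m C) = m i := by
  obtain ⟨A, -, h⟩ := exists_gaussianMeasure_eq_map m hC
  have hint (k : Fin d) : Integrable (fun z : Fin d → ℝ => A i k * z k) (stdGaussianPi d) :=
    ((memLp_eval_stdGaussianPi k).integrable (by norm_num)).const_mul _
  rw [h, integral_map (measurable_affine m A).aemeasurable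
    (measurable_pi_apply i).aestronglyMeasurable]
  simp only [Pi.add_apply, Matrix.mulVec, dotProduct]
  rw [integral_add (integrable_const _) (integrable_finsetSum _ fun k _ => hint k),
    integral_finsetSum _ fun k _ => hint k]
  simp [integral_const_mul, integral_eval_stdGaussianPi]

theorem integral_eval_mul_eval_gaussianMeasure (m : Fin d → ℝ) {C : Matrix (Fin d) (Fin d) ℝ}
    (hC : C.PosDef) (i j : Fin d) :
    ∫ x, x i * x j ∂(gaussianMeasure m C) = C i j + m i * m j := by
  obtain ⟨A, hCA, h⟩ := exists_gaussianMeasure_eq_map m hC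
  have hint (i k : Fin d) : Integrable (fun z : Fin d → ℝ => A i k * z k) (stdGaussianPi d) :=
    ((memLp_eval_stdGaussianPi k).integrable (by norm_num)).const_mul _
  have hint2 (k l : Fin d) : Integrable (fun z : Fin d → ℝ => A i k * A j l * (z k * z l))
      (stdGaussianPi d) :=
    ((memLp_eval_stdGaussianPi k).integrable_mul (memLp_eval_stdGaussianPi l)).const_mul _
  have hm2 : Measurable fun x : Fin d → ℝ => x i * x j :=
    (measurable_pi_apply i).mul (measurable_pi_apply j)
  rw [h, integral_map (measurable_affine m A).aemeasurable hm2.aestronglyMeasurable]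
  have hexp (z : Fin d → ℝ) : (m + A *ᵥ z) i * (m + A *ᵥ z) j =
      m i * m j + (m i * ∑ k, A j k * z k + m j * ∑ k, A i k * z k) +
        ∑ k, ∑ l, A i k * A j l * (z k * z l) := by
    have : ∑ k, ∑ l, A i k * A j l * (z k * z l) = (∑ k, A i k * z k) * ∑ l, A j l * z l := by
      rw [Finset.sum_mul_sum]
      exact Finset.sum_congr rfl fun k _ => Finset.sum_congr rfl fun l _ => by ring
    rw [this]
    simp only [Pi.add_apply, Matrix.mulVec, dotProduct]
    ring
  simp only [hexp]
  have hs (i : Fin d) : Integrable (fun z : Fin d → ℝ => ∑ k, A i k * z k) (stdGaussianPi d) :=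
    integrable_finsetSum _ fun k _ => hint i k
  have hs0 (c : ℝ) (i : Fin d) :
      ∫ z : Fin d → ℝ, c * ∑ k, A i k * z k ∂(stdGaussianPi d) = 0 := by
    rw [integral_const_mul, integral_finsetSum _ fun k _ => hint i k]
    simp [integral_const_mul, integral_eval_stdGaussianPi]
  have hs1 : Integrable (fun z : Fin d → ℝ => m i * ∑ k, A j k * z k + m j * ∑ k, A i k * z k)
      (stdGaussianPi d) := ((hs j).const_mul _).add ((hs i).const_mul _)
  have hs2 : Integrable (fun z : Fin d → ℝ => m i * m j +
      (m i * ∑ k, A j k * z k + m j * ∑ k, A i k * z k)) (stdGaussianPi d) :=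
    (integrable_const _).add hs1
  have hs3 : Integrable (fun z : Fin d → ℝ => ∑ k, ∑ l, A i k * A j l * (z k * z l))
      (stdGaussianPi d) :=
    integrable_finsetSum _ fun k _ => integrable_finsetSum _ fun l _ => hint2 k l
  rw [integral_add hs2 hs3, integral_add (integrable_const _) hs1,
    integral_add ((hs j).const_mul _) ((hs i).const_mul _), hs0, hs0, integral_finsetSum _ fun k _ => integrable_finsetSum _ fun l _ => hint2 k l]
  simp only [integral_finsetSum _ fun l _ => hint2 _ l, integral_const_mul,
    integral_eval_mul_eval_stdGaussianPi]
  simp [hCA, Matrix.mul_apply, add_comm]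

theorem integral_gaussianMeasure (m : Fin d → ℝ) {C : Matrix (Fin d) (Fin d) ℝ}
    (hC : C.PosDef) (g : (Fin d → ℝ) → ℝ) :
    ∫ x, g x ∂(gaussianMeasure m C) = ∫ x, gaussianDensity m C x * g x := by
  rw [gaussianMeasure, integral_withDensity_eq_integral_toReal_smul
    (measurable_gaussianDensity m C).ennreal_ofReal (by simp)]
  simp [ENNReal.toReal_ofReal (gaussianDensity_pos m hC _).le]

theorem integrable_gaussianMeasure_iff (m : Fin d → ℝ) {C : Matrix (Fin d) (Fin d) ℝ}
    (hC : C.PosDef) (g : (Fin d → ℝ) → ℝ) :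
    Integrable g (gaussianMeasure m C) ↔ Integrable fun x => gaussianDensity m C x * g x := by
  rw [gaussianMeasure, integrable_withDensity_iff_integrable_smul'
    (measurable_gaussianDensity m C).ennreal_ofReal (by simp)]
  simp [ENNReal.toReal_ofReal (gaussianDensity_pos m hC _).le]

/-- Polynomial functions of degree at most two. -/
def quadraticFunctions (d : ℕ) : Submodule ℝ ((Fin d → ℝ) → ℝ) :=
  Submodule.span ℝ ({fun _ => 1} ∪ Set.range (fun i x => x i) ∪
    Set.range fun (ij : Fin d × Fin d) x => x ij.1 * x ij.2)

theorem one_mem_quadraticFunctions : (fun _ => 1) ∈ quadraticFunctions d :=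
  Submodule.subset_span (Or.inl (Or.inl rfl))

theorem eval_mem_quadraticFunctions (i : Fin d) : (fun x => x i) ∈ quadraticFunctions d :=
  Submodule.subset_span (Or.inl (Or.inr ⟨i, rfl⟩))

theorem eval_mul_eval_mem_quadraticFunctions (i j : Fin d) :
    (fun x => x i * x j) ∈ quadraticFunctions d :=
  Submodule.subset_span (Or.inr ⟨(i, j), rfl⟩)

theorem const_mem_quadraticFunctions (c : ℝ) : (fun _ => c) ∈ quadraticFunctions d := by
  convert (quadraticFunctions d).smul_mem c one_mem_quadraticFunctions using 1
  ext x
  simp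

/-- This is why only moments up to order two matter in the divergence from a Gaussian density. -/
theorem log_gaussianDensity_mem_quadraticFunctions (m : Fin d → ℝ)
    {C : Matrix (Fin d) (Fin d) ℝ} (hC : C.PosDef) :
    (fun x => Real.log (gaussianDensity m C x)) ∈ quadraticFunctions d := by
  have hdet := hC.det_pos
  have h : (fun x => Real.log (gaussianDensity m C x)) =
      (fun _ => Real.log (Real.sqrt ((2 * Real.pi) ^ d * C.det))⁻¹) +
        ∑ i, ∑ j, (-(C⁻¹ i j) / 2) • ((fun x : Fin d → ℝ => x i * x j) +
          (-m j) • (fun x => x i) + (-m i) • (fun x => x j) + fun _ => m i * m j) := by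
    ext x
    unfold gaussianDensity
    rw [Real.log_mul (by positivity) (Real.exp_ne_zero _), Real.log_exp]
    simp only [Pi.add_apply, Finset.sum_apply, Pi.smul_apply, smul_eq_mul, dotProduct,
      Matrix.mulVec, Pi.sub_apply]
    congr 1
    rw [← Finset.sum_neg_distrib, Finset.sum_div]
    refine Finset.sum_congr rfl fun i _ => ?_
    rw [Finset.mul_sum, ← Finset.sum_neg_distrib, Finset.sum_div]
    refine Finset.sum_congr rfl fun j _ => ?_
    ring
  rw [h]
  refine add_mem (const_mem_quadraticFunctions _) (sum_mem fun i _ => sum_mem fun j _ =>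
    Submodule.smul_mem _ _ (add_mem (add_mem (add_mem ?_ ?_) ?_) ?_))
  · exact eval_mul_eval_mem_quadraticFunctions i j
  · exact Submodule.smul_mem _ _ (eval_mem_quadraticFunctions i)
  · exact Submodule.smul_mem _ _ (eval_mem_quadraticFunctions j)
  · exact const_mem_quadraticFunctions _

theorem integrable_quadratic_gaussianMeasure (m : Fin d → ℝ) {C : Matrix (Fin d) (Fin d) ℝ}
    (hC : C.PosDef) {g : (Fin d → ℝ) → ℝ} (hg : g ∈ quadraticFunctions d) :
    Integrable g (gaussianMeasure m C) := by
  have := isProbabilityMeasure_gaussianMeasure m hC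
  induction hg using Submodule.span_induction with
  | mem g hg =>
    rcases hg with (rfl | ⟨i, rfl⟩) | ⟨⟨i, j⟩, rfl⟩
    · exact integrable_const _
    · exact (memLp_eval_gaussianMeasure m hC i).integrable (by norm_num)
    · exact (memLp_eval_gaussianMeasure m hC i).integrable_mul (memLp_eval_gaussianMeasure m hC j)
  | zero => exact integrable_zero _ _ _
  | add g h _ _ hg hh => exact hg.add hh
  | smul c g _ hg => exact hg.smul c

/-- Integrals of quadratic functions against Gaussian measures only depend on the moments. -/
theorem sum_integral_quadratic_gaussianMeasure {ι : Type*} (s : Finset ι) (ω : ι → ℝ)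
    (ms : ι → Fin d → ℝ) (Cs : ι → Matrix (Fin d) (Fin d) ℝ) (hCs : ∀ a, (Cs a).PosDef)
    (R : ℝ) (m : Fin d → ℝ) {C : Matrix (Fin d) (Fin d) ℝ} (hC : C.PosDef)
    (h0 : ∑ a ∈ s, ω a = R) (h1 : ∀ i, ∑ a ∈ s, ω a * ms a i = R * m i)
    (h2 : ∀ i j, ∑ a ∈ s, ω a * (Cs a i j + ms a i * ms a j) = R * (C i j + m i * m j))
    {g : (Fin d → ℝ) → ℝ} (hg : g ∈ quadraticFunctions d) :
    ∑ a ∈ s, ω a * ∫ x, g x ∂(gaussianMeasure (ms a) (Cs a)) =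
      R * ∫ x, g x ∂(gaussianMeasure m C) := by
  have := isProbabilityMeasure_gaussianMeasure m hC
  have := fun a => isProbabilityMeasure_gaussianMeasure (ms a) (hCs a)
  induction hg using Submodule.span_induction with
  | mem g hg =>
    rcases hg with (rfl | ⟨i, rfl⟩) | ⟨⟨i, j⟩, rfl⟩
    · simpa using h0
    · simpa only [integral_eval_gaussianMeasure m hC, integral_eval_gaussianMeasure _ (hCs _)]
        using h1 i
    · simpa only [integral_eval_mul_eval_gaussianMeasure m hC,
        integral_eval_mul_eval_gaussianMeasure _ (hCs _)] using h2 i j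
  | zero => simp
  | add g h hg' hh' hg hh =>
    simp only [Pi.add_apply]
    rw [integral_add (integrable_quadratic_gaussianMeasure m hC hg')
      (integrable_quadratic_gaussianMeasure m hC hh'), mul_add, ← hg, ← hh,
      ← Finset.sum_add_distrib]
    refine Finset.sum_congr rfl fun a _ => ?_
    rw [integral_add (integrable_quadratic_gaussianMeasure _ (hCs a) hg')
      (integrable_quadratic_gaussianMeasure _ (hCs a) hh'), mul_add]
  | smul c g _ hg =>
    simp only [Pi.smul_apply, smul_eq_mul, integral_const_mul]
    simp only [mul_left_comm _ c]
    rw [← Finset.mul_sum, hg]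

theorem integral_gaussianDensity (m : Fin d → ℝ) {C : Matrix (Fin d) (Fin d) ℝ}
    (hC : C.PosDef) : ∫ x, gaussianDensity m C x = 1 := by
  have := isProbabilityMeasure_gaussianMeasure m hC
  have h := integral_gaussianMeasure m hC fun _ => 1
  simpa using h.symm

theorem integrable_gaussianDensity (m : Fin d → ℝ) {C : Matrix (Fin d) (Fin d) ℝ}
    (hC : C.PosDef) : Integrable (gaussianDensity m C) := by
  by_contra h
  have := integral_gaussianDensity m hC
  rw [integral_undef h] at this
  exact zero_ne_one this

/-- Mean and covariance are recovered from the measure as its moments. -/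
theorem eq_of_gaussianDensity_ae_eq {m m' : Fin d → ℝ} {C C' : Matrix (Fin d) (Fin d) ℝ}
    (hC : C.PosDef) (hC' : C'.PosDef)
    (h : gaussianDensity m C =ᵐ[volume] gaussianDensity m' C') : m = m' ∧ C = C' := by
  have hμ : gaussianMeasure m C = gaussianMeasure m' C' := by
    refine withDensity_congr_ae ?_
    filter_upwards [h] with x hx
    rw [hx]
  have hm : m = m' := by
    ext i
    rw [← integral_eval_gaussianMeasure m hC, hμ, integral_eval_gaussianMeasure m' hC']
  refine ⟨hm, ?_⟩
  ext i j
  have h2 := integral_eval_mul_eval_gaussianMeasure m hC i j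
  rw [hμ, integral_eval_mul_eval_gaussianMeasure m' hC', hm] at h2
  linarith

end GaussianDensity

/-! ### Gibbs' inequality for unnormalised densities -/

section Gibbs

/-- The integrand of the Kullback-Leibler divergence of unnormalised densities. -/
def gibbsTerm (s t : ℝ) : ℝ := s * Real.log (s / t) - s + t

theorem gibbsTerm_eq_mul_klFun {s t : ℝ} (ht : t ≠ 0) :
    gibbsTerm s t = t * InformationTheory.klFun (s / t) := by
  unfold gibbsTerm InformationTheory.klFun
  field_simp
  ring

/-- The condition on zeros cannot be dropped: as `s / 0 = 0` and `Real.log 0 = 0`, the value of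
`gibbsTerm s 0` is `-s`. -/
theorem gibbsTerm_nonneg {s t : ℝ} (hs : 0 ≤ s) (ht : 0 ≤ t) (h : t = 0 → s = 0) :
    0 ≤ gibbsTerm s t := by
  by_cases h0 : t = 0
  · simp [gibbsTerm, h0, h h0]
  · rw [gibbsTerm_eq_mul_klFun h0]
    exact mul_nonneg ht (InformationTheory.klFun_nonneg (div_nonneg hs ht))

theorem gibbsTerm_eq_zero_iff {s t : ℝ} (hs : 0 ≤ s) (ht : 0 ≤ t) (h : t = 0 → s = 0) :
    gibbsTerm s t = 0 ↔ s = t := by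
  by_cases h0 : t = 0
  · simp [gibbsTerm, h0, h h0]
  · rw [gibbsTerm_eq_mul_klFun h0, mul_eq_zero, or_iff_right h0,
      InformationTheory.klFun_eq_zero_iff (div_nonneg hs ht), div_eq_one_iff_eq h0]

theorem gibbsTerm_self (s : ℝ) : gibbsTerm s s = 0 := by
  by_cases h : s = 0 <;> simp [gibbsTerm, h]

variable {Ω : Type*} [MeasurableSpace Ω] {μ : Measure Ω} {s t : Ω → ℝ}

theorem integral_gibbsTerm (hs : Integrable s μ) (ht : Integrable t μ)
    (h : Integrable (fun x => s x * Real.log (s x / t x)) μ) :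
    ∫ x, gibbsTerm (s x) (t x) ∂μ =
      ∫ x, s x * Real.log (s x / t x) ∂μ - ∫ x, s x ∂μ + ∫ x, t x ∂μ := by
  have h' : Integrable (fun x => s x * Real.log (s x / t x) - s x) μ := h.sub hs
  unfold gibbsTerm
  rw [integral_add h' ht, integral_sub h hs]

theorem integral_gibbsTerm_nonneg (hs0 : ∀ x, 0 ≤ s x) (ht0 : ∀ x, 0 ≤ t x)
    (hac : ∀ᵐ x ∂μ, t x = 0 → s x = 0) : 0 ≤ ∫ x, gibbsTerm (s x) (t x) ∂μ := by
  refine integral_nonneg_of_ae ?_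
  filter_upwards [hac] with x hx
  exact gibbsTerm_nonneg (hs0 x) (ht0 x) hx

theorem integral_gibbsTerm_eq_zero_iff (hs0 : ∀ x, 0 ≤ s x) (ht0 : ∀ x, 0 ≤ t x)
    (hs : Integrable s μ) (ht : Integrable t μ)
    (h : Integrable (fun x => s x * Real.log (s x / t x)) μ)
    (hac : ∀ᵐ x ∂μ, t x = 0 → s x = 0) :
    ∫ x, gibbsTerm (s x) (t x) ∂μ = 0 ↔ s =ᵐ[μ] t := by
  have hint : Integrable (fun x => gibbsTerm (s x) (t x)) μ := (h.sub hs).add ht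
  have hnn : 0 ≤ᵐ[μ] fun x => gibbsTerm (s x) (t x) := by
    filter_upwards [hac] with x hx
    exact gibbsTerm_nonneg (hs0 x) (ht0 x) hx
  rw [integral_eq_zero_iff_of_nonneg_ae hnn hint]
  constructor
  · intro h0
    filter_upwards [h0, hac] with x hx hx'
    exact (gibbsTerm_eq_zero_iff (hs0 x) (ht0 x) hx').1 hx
  · intro h0
    filter_upwards [h0] with x hx
    rw [hx, gibbsTerm_self, Pi.zero_apply]

theorem ofReal_mul_logRatioPos_eq {s t : ℝ} (hs : 0 ≤ s) (h : t = 0 → s = 0) :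
    ENNReal.ofReal s * logRatioPos s t = ENNReal.ofReal (s * Real.log (s / t)) := by
  by_cases h0 : s = 0
  · simp [h0]
  · rw [logRatioPos, if_neg (fun h' => h0 (h h'.2)), ENNReal.ofReal_mul hs]

theorem ofReal_mul_logRatioNeg_eq {s : ℝ} (t : ℝ) (hs : 0 ≤ s) :
    ENNReal.ofReal s * logRatioNeg s t = ENNReal.ofReal (-(s * Real.log (s / t))) := by
  rw [logRatioNeg, ← ENNReal.ofReal_mul hs, mul_neg]

theorem ofReal_mul_logRatioPos_ne_top_iff {s t : ℝ} (hs : 0 ≤ s) :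
    ENNReal.ofReal s * logRatioPos s t ≠ ∞ ↔ (t = 0 → s = 0) := by
  constructor
  · intro h h0
    by_contra hs0
    refine h ?_
    rw [logRatioPos, if_pos ⟨hs0, h0⟩, ENNReal.mul_top]
    simpa using lt_of_le_of_ne hs (Ne.symm hs0)
  · intro h
    rw [ofReal_mul_logRatioPos_eq hs h]
    exact ENNReal.ofReal_ne_top

theorem toReal_ofReal_mul_logRatioPos_sub {s t : ℝ} (hs : 0 ≤ s) (h : t = 0 → s = 0) :
    (ENNReal.ofReal s * logRatioPos s t).toReal - (ENNReal.ofReal s * logRatioNeg s t).toReal =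
      s * Real.log (s / t) := by
  rw [ofReal_mul_logRatioPos_eq hs h, ofReal_mul_logRatioNeg_eq t hs, ENNReal.toReal_ofReal',
    ENNReal.toReal_ofReal', max_zero_sub_max_neg_zero_eq_self]

theorem lintegral_logRatioNeg_ne_top (hs0 : ∀ x, 0 ≤ s x) (ht0 : ∀ x, 0 ≤ t x)
    (ht : Integrable t μ) : ∫⁻ x, ENNReal.ofReal (s x) * logRatioNeg (s x) (t x) ∂μ ≠ ∞ := by
  refine ne_top_of_le_ne_top ?_
    (lintegral_mono fun x => ofReal_mul_logRatioNeg_le (hs0 x) (ht0 x))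
  rw [← ofReal_integral_eq_lintegral_ofReal ht (Filter.Eventually.of_forall ht0)]
  exact ENNReal.ofReal_ne_top

/-- A finite integral excludes the value `∞` almost everywhere, which gives absolute continuity.
Since the negative part is always integrable, finiteness of the positive part is then the same as
integrability. -/
theorem lintegral_logRatioPos_ne_top_iff (hsm : Measurable s) (htm : Measurable t)
    (hs0 : ∀ x, 0 ≤ s x) (ht0 : ∀ x, 0 ≤ t x) (ht : Integrable t μ) :
    ∫⁻ x, ENNReal.ofReal (s x) * logRatioPos (s x) (t x) ∂μ ≠ ∞ ↔
      (∀ᵐ x ∂μ, t x = 0 → s x = 0) ∧ Integrable (fun x => s x * Real.log (s x / t x)) μ := by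
  have hpm : Measurable fun x => ENNReal.ofReal (s x) * logRatioPos (s x) (t x) :=
    hsm.ennreal_ofReal.mul (measurable_logRatioPos.comp (hsm.prodMk htm))
  have hfm : Measurable fun x => s x * Real.log (s x / t x) := by fun_prop
  constructor
  · intro h
    have hac : ∀ᵐ x ∂μ, t x = 0 → s x = 0 := by
      filter_upwards [ae_lt_top hpm h] with x hx
      exact (ofReal_mul_logRatioPos_ne_top_iff (hs0 x)).1 hx.ne
    refine ⟨hac, hfm.aestronglyMeasurable, ?_⟩
    have hneg := lintegral_logRatioNeg_ne_top hs0 ht0 ht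
    refine lt_of_le_of_lt (lintegral_mono_ae (g := fun x =>
      ENNReal.ofReal (s x) * logRatioPos (s x) (t x) +
        ENNReal.ofReal (s x) * logRatioNeg (s x) (t x)) ?_) ?_
    · filter_upwards [hac] with x hx
      rw [ofReal_mul_logRatioPos_eq (hs0 x) hx, ofReal_mul_logRatioNeg_eq _ (hs0 x),
        Real.enorm_eq_ofReal_abs]
      rcases abs_cases (s x * Real.log (s x / t x)) with h | h <;> rw [h.1]
      · exact le_self_add
      · exact le_add_self
    · rw [lintegral_add_left hpm]
      exact ENNReal.add_lt_top.2 ⟨h.lt_top, hneg.lt_top⟩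
  · rintro ⟨hac, hint⟩
    have : ∫⁻ x, ENNReal.ofReal (s x) * logRatioPos (s x) (t x) ∂μ =
        ∫⁻ x, ENNReal.ofReal (s x * Real.log (s x / t x)) ∂μ := by
      refine lintegral_congr_ae ?_
      filter_upwards [hac] with x hx
      exact ofReal_mul_logRatioPos_eq (hs0 x) hx
    rw [this]
    exact hint.lintegral_lt_top.ne

theorem toReal_lintegral_logRatioPos_sub (hs0 : ∀ x, 0 ≤ s x)
    (hac : ∀ᵐ x ∂μ, t x = 0 → s x = 0)
    (hint : Integrable (fun x => s x * Real.log (s x / t x)) μ) :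
    (∫⁻ x, ENNReal.ofReal (s x) * logRatioPos (s x) (t x) ∂μ).toReal -
      (∫⁻ x, ENNReal.ofReal (s x) * logRatioNeg (s x) (t x) ∂μ).toReal =
      ∫ x, s x * Real.log (s x / t x) ∂μ := by
  have : ∫⁻ x, ENNReal.ofReal (s x) * logRatioPos (s x) (t x) ∂μ =
      ∫⁻ x, ENNReal.ofReal (s x * Real.log (s x / t x)) ∂μ := by
    refine lintegral_congr_ae ?_
    filter_upwards [hac] with x hx
    exact ofReal_mul_logRatioPos_eq (hs0 x) hx
  rw [this, integral_eq_lintegral_pos_part_sub_lintegral_neg_part hint]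
  simp only [ofReal_mul_logRatioNeg_eq _ (hs0 _)]

end Gibbs

/-! ### Divergence between Gaussian Bernoulli densities and moment matching -/

section GaussianDivergence

variable {d : ℕ}

theorem mul_log_div {s t : ℝ} (h : t = 0 → s = 0) :
    s * Real.log (s / t) = s * Real.log s - s * Real.log t := by
  by_cases hs : s = 0
  · simp [hs]
  · rw [Real.log_div hs fun ht => hs (h ht), mul_sub]

/-- The Kullback-Leibler divergence between two Gaussian densities. -/
def gaussianDivergence (m : Fin d → ℝ) (C : Matrix (Fin d) (Fin d) ℝ) (m' : Fin d → ℝ)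
    (C' : Matrix (Fin d) (Fin d) ℝ) : ℝ :=
  ∫ x, Real.log (gaussianDensity m C x) ∂(gaussianMeasure m C) -
    ∫ x, Real.log (gaussianDensity m' C' x) ∂(gaussianMeasure m C)

variable {m m' : Fin d → ℝ} {C C' : Matrix (Fin d) (Fin d) ℝ}

theorem integrable_gaussianDensity_mul_log (hC : C.PosDef) (hC' : C'.PosDef) :
    Integrable fun x => gaussianDensity m C x * Real.log (gaussianDensity m' C' x) :=
  (integrable_gaussianMeasure_iff m hC _).1 (integrable_quadratic_gaussianMeasure m hC
    (log_gaussianDensity_mem_quadraticFunctions m' hC'))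

theorem bernoulli_mul_log_eq {r r' : ℝ} (hC : C.PosDef) (hC' : C'.PosDef) (h : r' = 0 → r = 0)
    (x : Fin d → ℝ) :
    r * gaussianDensity m C x *
        Real.log (r * gaussianDensity m C x / (r' * gaussianDensity m' C' x)) =
      r * Real.log (r / r') * gaussianDensity m C x +
        r * (gaussianDensity m C x * Real.log (gaussianDensity m C x)) -
        r * (gaussianDensity m C x * Real.log (gaussianDensity m' C' x)) := by
  by_cases hr : r = 0
  · simp [hr]
  have hr' : r' ≠ 0 := fun h' => hr (h h')
  have h1 := (gaussianDensity_pos m hC x).ne'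
  have h2 := (gaussianDensity_pos m' hC' x).ne'
  rw [mul_div_mul_comm, Real.log_mul (div_ne_zero hr hr') (div_ne_zero h1 h2), Real.log_div h1 h2]
  ring

theorem integrable_bernoulli_mul_log {r r' : ℝ} (hC : C.PosDef) (hC' : C'.PosDef)
    (h : r' = 0 → r = 0) :
    Integrable fun x => r * gaussianDensity m C x *
        Real.log (r * gaussianDensity m C x / (r' * gaussianDensity m' C' x)) := by
  simp only [bernoulli_mul_log_eq hC hC' h]
  exact (((integrable_gaussianDensity m hC).const_mul _).add
    ((integrable_gaussianDensity_mul_log hC hC).const_mul _)).sub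
    ((integrable_gaussianDensity_mul_log hC hC').const_mul _)

theorem integral_bernoulli_mul_log {r r' : ℝ} (hC : C.PosDef) (hC' : C'.PosDef)
    (h : r' = 0 → r = 0) :
    ∫ x, r * gaussianDensity m C x *
        Real.log (r * gaussianDensity m C x / (r' * gaussianDensity m' C' x)) =
      r * Real.log (r / r') + r * gaussianDivergence m C m' C' := by
  have h1 := (integrable_gaussianDensity m hC).const_mul (r * Real.log (r / r'))
  have h2 := (integrable_gaussianDensity_mul_log (m := m) (m' := m) hC hC).const_mul r
  have h3 := (integrable_gaussianDensity_mul_log (m := m) (m' := m') hC hC').const_mul r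
  simp only [bernoulli_mul_log_eq hC hC' h]
  have h12 : Integrable fun x => r * Real.log (r / r') * gaussianDensity m C x +
      r * (gaussianDensity m C x * Real.log (gaussianDensity m C x)) := h1.add h2
  rw [integral_sub h12 h3, integral_add h1 h2, integral_const_mul, integral_const_mul,
    integral_const_mul, integral_gaussianDensity m hC, gaussianDivergence,
    integral_gaussianMeasure m hC, integral_gaussianMeasure m hC]
  ring

theorem integral_gibbsTerm_gaussianDensity (hC : C.PosDef) (hC' : C'.PosDef) :
    ∫ x, gibbsTerm (gaussianDensity m C x) (gaussianDensity m' C' x) =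
      gaussianDivergence m C m' C' := by
  have h1 := integrable_bernoulli_mul_log (m := m) (m' := m') (r := 1) (r' := 1) hC hC' (by simp)
  have h2 := integral_bernoulli_mul_log (m := m) (m' := m') (r := 1) (r' := 1) hC hC' (by simp)
  simp only [one_mul, div_one, Real.log_one, zero_add] at h1 h2
  rw [integral_gibbsTerm (integrable_gaussianDensity m hC) (integrable_gaussianDensity m' hC') h1,
    h2, integral_gaussianDensity m hC, integral_gaussianDensity m' hC']
  ring

theorem gaussianDivergence_nonneg (hC : C.PosDef) (hC' : C'.PosDef) :
    0 ≤ gaussianDivergence m C m' C' := by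
  rw [← integral_gibbsTerm_gaussianDensity hC hC']
  exact integral_gibbsTerm_nonneg (fun x => (gaussianDensity_pos m hC x).le)
    (fun x => (gaussianDensity_pos m' hC' x).le)
    (Filter.Eventually.of_forall fun x h => absurd h (gaussianDensity_pos m' hC' x).ne')

theorem gaussianDivergence_eq_zero_iff (hC : C.PosDef) (hC' : C'.PosDef) :
    gaussianDivergence m C m' C' = 0 ↔ m = m' ∧ C = C' := by
  have h1 := integrable_bernoulli_mul_log (m := m) (m' := m') (r := 1) (r' := 1) hC hC' (by simp)
  simp only [one_mul] at h1
  rw [← integral_gibbsTerm_gaussianDensity hC hC', integral_gibbsTerm_eq_zero_iff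
    (fun x => (gaussianDensity_pos m hC x).le) (fun x => (gaussianDensity_pos m' hC' x).le)
    (integrable_gaussianDensity m hC) (integrable_gaussianDensity m' hC') h1
    (Filter.Eventually.of_forall fun x h => absurd h (gaussianDensity_pos m' hC' x).ne')]
  refine ⟨eq_of_gaussianDensity_ae_eq hC hC', ?_⟩
  rintro ⟨rfl, rfl⟩
  rfl

/-- The excess divergence of a Gaussian Bernoulli density with parameters `r'`, `m'`, `C'` over the
one with parameters `R`, `m`, `C`. -/
def bernoulliExcess (R : ℝ) (m : Fin d → ℝ) (C : Matrix (Fin d) (Fin d) ℝ) (r' : ℝ)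
    (m' : Fin d → ℝ) (C' : Matrix (Fin d) (Fin d) ℝ) : ℝ :=
  gibbsTerm R r' + gibbsTerm (1 - R) (1 - r') + R * gaussianDivergence m C m' C'

theorem bernoulliExcess_nonneg {R r' : ℝ} (hR : 0 ≤ R) (hR1 : R ≤ 1) (hr' : 0 ≤ r') (hr1 : r' ≤ 1)
    (h0 : r' = 0 → R = 0) (h1 : 1 - r' = 0 → 1 - R = 0) (hC : C.PosDef) (hC' : C'.PosDef) :
    0 ≤ bernoulliExcess R m C r' m' C' :=
  add_nonneg (add_nonneg (gibbsTerm_nonneg hR hr' h0)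
    (gibbsTerm_nonneg (sub_nonneg.2 hR1) (sub_nonneg.2 hr1) h1))
    (mul_nonneg hR (gaussianDivergence_nonneg hC hC'))

theorem bernoulliExcess_eq_zero_iff {R r' : ℝ} (hR : 0 ≤ R) (hR1 : R ≤ 1) (hr' : 0 ≤ r')
    (hr1 : r' ≤ 1) (h0 : r' = 0 → R = 0) (h1 : 1 - r' = 0 → 1 - R = 0) (hC : C.PosDef)
    (hC' : C'.PosDef) :
    bernoulliExcess R m C r' m' C' = 0 ↔ r' = R ∧ (R ≠ 0 → m' = m ∧ C' = C) := by
  have n0 := gibbsTerm_nonneg hR hr' h0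
  have n1 := gibbsTerm_nonneg (sub_nonneg.2 hR1) (sub_nonneg.2 hr1) h1
  have n2 := mul_nonneg hR (gaussianDivergence_nonneg (m := m) (m' := m') hC hC')
  unfold bernoulliExcess
  rw [add_eq_zero_iff_of_nonneg (add_nonneg n0 n1) n2, add_eq_zero_iff_of_nonneg n0 n1,
    gibbsTerm_eq_zero_iff hR hr' h0,
    gibbsTerm_eq_zero_iff (sub_nonneg.2 hR1) (sub_nonneg.2 hr1) h1, mul_eq_zero,
    gaussianDivergence_eq_zero_iff hC hC']
  constructor
  · rintro ⟨⟨h, -⟩, h2⟩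
    exact ⟨h.symm, fun hne => ⟨((h2.resolve_left hne).1).symm, ((h2.resolve_left hne).2).symm⟩⟩
  · rintro ⟨rfl, h⟩
    refine ⟨⟨rfl, rfl⟩, or_iff_not_imp_left.2 fun hne => ?_⟩
    exact ⟨(h hne).1.symm, (h hne).2.symm⟩

/-- The divergence of a mixture of Gaussian Bernoulli densities from a Gaussian Bernoulli density
is the excess over the Bernoulli density with matched moments, up to a constant. -/
theorem sum_bernoulli_divergence_eq {ι : Type*} (s : Finset ι) {w r : ι → ℝ}
    {ms : ι → Fin d → ℝ} {Cs : ι → Matrix (Fin d) (Fin d) ℝ} (hCs : ∀ a, (Cs a).PosDef)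
    {R : ℝ} (hC : C.PosDef) (hw : ∑ a ∈ s, w a = 1) (hwr : ∑ a ∈ s, w a * r a = R)
    (hmean : ∀ i, ∑ a ∈ s, w a * r a * ms a i = R * m i)
    (hcov : ∀ i j, ∑ a ∈ s, w a * r a * (Cs a i j + ms a i * ms a j) = R * (C i j + m i * m j))
    {r' : ℝ} (hC' : C'.PosDef) (h0 : ∀ a ∈ s, w a ≠ 0 → r' = 0 → r a = 0)
    (h1 : ∀ a ∈ s, w a ≠ 0 → 1 - r' = 0 → 1 - r a = 0) :
    ∑ a ∈ s, w a * ((∫ x, r a * gaussianDensity (ms a) (Cs a) x *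
        Real.log (r a * gaussianDensity (ms a) (Cs a) x / (r' * gaussianDensity m' C' x))) +
        (1 - r a) * Real.log ((1 - r a) / (1 - r'))) =
      ∑ a ∈ s, w a * (r a * Real.log (r a) + (1 - r a) * Real.log (1 - r a) +
          r a * ∫ x, Real.log (gaussianDensity (ms a) (Cs a) x) ∂(gaussianMeasure (ms a) (Cs a))) -
        (R * Real.log R + (1 - R) * Real.log (1 - R) +
          R * ∫ x, Real.log (gaussianDensity m C x) ∂(gaussianMeasure m C)) +
        bernoulliExcess R m C r' m' C' := by
  -- Each summand depends on `r'`, `m'`, `C'` only through `log r'`, `log (1 - r')` and the integral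
  -- of a quadratic function. After summation over `a` their coefficients are `R` and `1 - R`, and
  -- the integral is `R` times that against the Gaussian measure with matched moments.
  have hterm : ∀ a ∈ s, w a * ((∫ x, r a * gaussianDensity (ms a) (Cs a) x *
        Real.log (r a * gaussianDensity (ms a) (Cs a) x / (r' * gaussianDensity m' C' x))) +
        (1 - r a) * Real.log ((1 - r a) / (1 - r'))) =
      w a * (r a * Real.log (r a) + (1 - r a) * Real.log (1 - r a) +
          r a * ∫ x, Real.log (gaussianDensity (ms a) (Cs a) x) ∂(gaussianMeasure (ms a) (Cs a))) -
        w a * r a * Real.log r' - (w a - w a * r a) * Real.log (1 - r') -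
        w a * r a * ∫ x, Real.log (gaussianDensity m' C' x) ∂(gaussianMeasure (ms a) (Cs a)) := by
    intro a ha
    by_cases hwa : w a = 0
    · simp [hwa]
    rw [integral_bernoulli_mul_log (hCs a) hC' (h0 a ha hwa), mul_log_div (h0 a ha hwa),
      mul_log_div (h1 a ha hwa), gaussianDivergence]
    ring
  have hR0 : r' = 0 → R = 0 := by
    intro h
    rw [← hwr]
    refine Finset.sum_eq_zero fun a ha => ?_
    by_cases hwa : w a = 0
    · rw [hwa, zero_mul]
    · rw [h0 a ha hwa h, mul_zero]
  have hR1 : 1 - r' = 0 → 1 - R = 0 := by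
    intro h
    rw [← hwr, ← hw, ← Finset.sum_sub_distrib]
    refine Finset.sum_eq_zero fun a ha => ?_
    by_cases hwa : w a = 0
    · rw [hwa, zero_mul, sub_zero]
    · have := h1 a ha hwa h
      linear_combination w a * this
  rw [Finset.sum_congr rfl hterm, Finset.sum_sub_distrib, Finset.sum_sub_distrib,
    Finset.sum_sub_distrib, ← Finset.sum_mul, ← Finset.sum_mul, Finset.sum_sub_distrib, hw, hwr,
    sum_integral_quadratic_gaussianMeasure s (fun a => w a * r a) ms Cs hCs R m hC hwr hmean hcov
      (log_gaussianDensity_mem_quadraticFunctions m' hC'), bernoulliExcess, gibbsTerm, gibbsTerm,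
    mul_log_div hR0, mul_log_div hR1, gaussianDivergence]
  ring

end GaussianDivergence

/-! ### Finiteness of the divergence and its real value -/

section PMBDivergence

variable {n d : ℕ}

/-- The Kullback-Leibler divergence between two Poisson multi-Bernoulli densities with total masses
`w` and `w'`. -/
def pmbDivergence (w w' : ℝ) (lam lam' : PPPIntensity d) (b b' : Fin n → BernoulliParam d) : ℝ :=
  w * (Real.log (w / w') + ((∫ x, lam'.val x) - ∫ x, lam.val x) +
    (∫ x, lam.val x * Real.log (lam.val x / lam'.val x)) +
    ∑ i, ((∫ x, (b i).r * (b i).p x *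
        Real.log ((b i).r * (b i).p x / ((b' i).r * (b' i).p x))) +
      (1 - (b i).r) * Real.log ((1 - (b i).r) / (1 - (b' i).r))))

/-- The conditions under which the divergence between two Poisson multi-Bernoulli densities is
finite. -/
def HasFiniteDivergence (w w' : ℝ) (lam lam' : PPPIntensity d) (b b' : Fin n → BernoulliParam d) :
    Prop :=
  w ≠ 0 → w' ≠ 0 ∧ ((∀ᵐ x, lam'.val x = 0 → lam.val x = 0) ∧
      Integrable fun x => lam.val x * Real.log (lam.val x / lam'.val x)) ∧
    ∀ i, ((∀ᵐ x, (b' i).r * (b' i).p x = 0 → (b i).r * (b i).p x = 0) ∧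
      Integrable fun x => (b i).r * (b i).p x *
        Real.log ((b i).r * (b i).p x / ((b' i).r * (b' i).p x))) ∧
      (1 - (b' i).r = 0 → 1 - (b i).r = 0)

theorem logRatioPos_ne_top_iff {s t : ℝ} : logRatioPos s t ≠ ∞ ↔ (t = 0 → s = 0) := by
  unfold logRatioPos
  split_ifs with h
  · simp [h.1, h.2]
  · push Not at h
    simp only [ne_eq, ENNReal.ofReal_ne_top, not_false_eq_true, true_iff]
    exact fun ht => by_contra fun hs => h hs ht

theorem toReal_logRatioPos_sub {s t : ℝ} (h : t = 0 → s = 0) :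
    (logRatioPos s t).toReal - (logRatioNeg s t).toReal = Real.log (s / t) := by
  rw [logRatioPos, if_neg (fun h' => h'.1 (h h'.2)), logRatioNeg, ENNReal.toReal_ofReal',
    ENNReal.toReal_ofReal', max_zero_sub_max_neg_zero_eq_self]

variable {w w' : ℝ} {lam lam' : PPPIntensity d} {b b' : Fin n → BernoulliParam d}

theorem BernoulliParam.mul_nonneg (b : BernoulliParam d) (x : Fin d → ℝ) : 0 ≤ b.r * b.p x :=
  _root_.mul_nonneg b.r_nonneg (b.p_nonneg x)

/-- A sum in `[0, ∞]` is finite exactly when each term is. For `w = 0` the factor in front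
annihilates everything, so no condition is imposed. -/
theorem divergencePos_ne_top_iff (hw : 0 ≤ w) :
    divergencePos w w' lam lam' b b' ≠ ∞ ↔ HasFiniteDivergence w w' lam lam' b b' := by
  unfold HasFiniteDivergence
  by_cases h0 : w = 0
  · simp [divergencePos, h0]
  have hw0 : ENNReal.ofReal w ≠ 0 := by simpa using lt_of_le_of_ne hw (Ne.symm h0)
  have hmul (z : ℝ≥0∞) : ENNReal.ofReal w * z ≠ ∞ ↔ z ≠ ∞ :=
    ⟨fun h hz => h (by rw [hz, ENNReal.mul_top hw0]), ENNReal.mul_ne_top ENNReal.ofReal_ne_top⟩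
  have hexp : logRatioPos (Real.exp (-∫ x, lam.val x)) (Real.exp (-∫ x, lam'.val x)) ≠ ∞ :=
    logRatioPos_ne_top_iff.2 fun h => absurd h (Real.exp_pos _).ne'
  have hlam := lintegral_logRatioPos_ne_top_iff (μ := volume) lam.measurable lam'.measurable
    lam.nonneg lam'.nonneg lam'.integrable
  have hb (i : Fin n) := lintegral_logRatioPos_ne_top_iff (μ := volume)
    ((b i).p_measurable.const_mul (b i).r) ((b' i).p_measurable.const_mul (b' i).r)
    (b i).mul_nonneg (b' i).mul_nonneg ((b' i).integrable.const_mul _)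
  rw [divergencePos, hmul, ENNReal.add_ne_top, ENNReal.add_ne_top, ENNReal.add_ne_top,
    Fin.sum_univ_succ, ENNReal.add_ne_top, ENNReal.sum_ne_top, ENNReal.sum_ne_top]
  simp only [pointDensity, Fin.cases_zero, Fin.cases_succ, hlam, hb, logRatioPos_ne_top_iff,
    ofReal_mul_logRatioPos_ne_top_iff (sub_nonneg.2 (b _).r_le_one), Finset.mem_univ, true_imp_iff]
  constructor
  · rintro ⟨⟨⟨h1, -⟩, h2, h3⟩, h4⟩ -
    exact ⟨fun h => h0 (h1 h), h2, fun i => ⟨h3 i, h4 i⟩⟩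
  · intro h
    obtain ⟨h1, h2, h3⟩ := h h0
    exact ⟨⟨⟨fun h => absurd h h1, fun h => absurd h (Real.exp_pos _).ne'⟩, h2,
      fun i => (h3 i).1⟩, fun i => (h3 i).2⟩

theorem toReal_divergencePos_sub (hw : 0 ≤ w) (h : HasFiniteDivergence w w' lam lam' b b') :
    (divergencePos w w' lam lam' b b').toReal - (divergenceNeg w w' lam lam' b b').toReal =
      pmbDivergence w w' lam lam' b b' := by
  by_cases h0 : w = 0
  · simp [divergencePos, divergenceNeg, pmbDivergence, h0]
  have hp := (divergencePos_ne_top_iff hw).2 h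
  have hn := divergenceNeg_ne_top w w' lam lam' b b'
  obtain ⟨h1, ⟨h2, h2'⟩, h3⟩ := h h0
  have hw0 : ENNReal.ofReal w ≠ 0 := by simpa using lt_of_le_of_ne hw (Ne.symm h0)
  have hfin {z : ℝ≥0∞} (hz : ENNReal.ofReal w * z ≠ ∞) : z ≠ ∞ :=
    fun h => hz (by rw [h, ENNReal.mul_top hw0])
  have hp' := hfin hp
  have hn' := hfin hn
  rw [divergencePos, divergenceNeg, ENNReal.toReal_mul, ENNReal.toReal_mul, ENNReal.toReal_ofReal hw,
    ← mul_sub, pmbDivergence]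
  congr 1
  rw [ENNReal.add_ne_top, ENNReal.add_ne_top, ENNReal.add_ne_top, Fin.sum_univ_succ,
    ENNReal.add_ne_top, ENNReal.sum_ne_top, ENNReal.sum_ne_top] at hp' hn'
  obtain ⟨⟨⟨p1, p2⟩, p3, p4⟩, p5⟩ := hp'
  obtain ⟨⟨⟨n1, n2⟩, n3, n4⟩, n5⟩ := hn'
  rw [Fin.sum_univ_succ, Fin.sum_univ_succ]
  rw [ENNReal.toReal_add (ENNReal.add_ne_top.2 ⟨ENNReal.add_ne_top.2 ⟨p1, p2⟩,
      ENNReal.add_ne_top.2 ⟨p3, ENNReal.sum_ne_top.2 p4⟩⟩) (ENNReal.sum_ne_top.2 p5),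
    ENNReal.toReal_add (ENNReal.add_ne_top.2 ⟨p1, p2⟩)
      (ENNReal.add_ne_top.2 ⟨p3, ENNReal.sum_ne_top.2 p4⟩),
    ENNReal.toReal_add p1 p2, ENNReal.toReal_add p3 (ENNReal.sum_ne_top.2 p4),
    ENNReal.toReal_sum p4, ENNReal.toReal_sum p5]
  rw [ENNReal.toReal_add (ENNReal.add_ne_top.2 ⟨ENNReal.add_ne_top.2 ⟨n1, n2⟩,
      ENNReal.add_ne_top.2 ⟨n3, ENNReal.sum_ne_top.2 n4⟩⟩) (ENNReal.sum_ne_top.2 n5),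
    ENNReal.toReal_add (ENNReal.add_ne_top.2 ⟨n1, n2⟩)
      (ENNReal.add_ne_top.2 ⟨n3, ENNReal.sum_ne_top.2 n4⟩),
    ENNReal.toReal_add n1 n2, ENNReal.toReal_add n3 (ENNReal.sum_ne_top.2 n4),
    ENNReal.toReal_sum n4, ENNReal.toReal_sum n5]
  have e1 := toReal_logRatioPos_sub (s := w) (t := w') fun h => absurd h h1
  have e2 := toReal_logRatioPos_sub (s := Real.exp (-∫ x, lam.val x))
    (t := Real.exp (-∫ x, lam'.val x)) fun h => absurd h (Real.exp_pos _).ne'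
  rw [← Real.exp_sub, Real.log_exp] at e2
  have e3 := toReal_lintegral_logRatioPos_sub lam.nonneg h2 h2'
  have e4 (i : Fin n) := toReal_lintegral_logRatioPos_sub (b i).mul_nonneg (h3 i).1.1 (h3 i).1.2
  have e5 (i : Fin n) := toReal_ofReal_mul_logRatioPos_sub (sub_nonneg.2 (b i).r_le_one) (h3 i).2
  rw [Finset.sum_add_distrib]
  simp only [← e4, ← e5, Finset.sum_sub_distrib]
  simp only [pointDensity, Fin.cases_zero, Fin.cases_succ]
  linarith

end PMBDivergence

/-! ### Sums and differences of extended reals -/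

section EReal

theorem ereal_coe_sum {ι : Type*} (s : Finset ι) (g : ι → ℝ) :
    ((∑ a ∈ s, g a : ℝ) : EReal) = ∑ a ∈ s, (g a : EReal) := by
  classical
  induction s using Finset.induction_on with
  | empty => simp
  | insert a s ha ih => rw [Finset.sum_insert ha, Finset.sum_insert ha, EReal.coe_add, ih]

theorem ereal_sum_ne_bot {ι : Type*} (s : Finset ι) {g : ι → EReal} (hg : ∀ a ∈ s, g a ≠ ⊥) :
    ∑ a ∈ s, g a ≠ ⊥ := by
  classical
  induction s using Finset.induction_on with
  | empty => simp
  | insert a s ha ih =>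
    rw [Finset.sum_insert ha, ne_eq, EReal.add_eq_bot_iff, not_or]
    exact ⟨hg a (by simp), ih fun c hc => hg c (by simp [hc])⟩

theorem ereal_sum_eq_top {ι : Type*} (s : Finset ι) {g : ι → EReal} (hg : ∀ a ∈ s, g a ≠ ⊥)
    {a : ι} (ha : a ∈ s) (h : g a = ⊤) : ∑ a ∈ s, g a = ⊤ := by
  classical
  rw [← Finset.add_sum_erase s g ha, h]
  exact EReal.top_add_of_ne_bot (ereal_sum_ne_bot _ fun c hc => hg c (Finset.mem_of_mem_erase hc))

theorem ereal_coe_ennreal_sub_ne_bot {u v : ℝ≥0∞} (hv : v ≠ ∞) :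
    (u : EReal) - (v : EReal) ≠ ⊥ := by
  lift v to NNReal using hv
  rw [sub_eq_add_neg, ne_eq, EReal.add_eq_bot_iff, not_or]
  refine ⟨EReal.coe_ennreal_ne_bot _, ?_⟩
  rw [EReal.neg_eq_bot_iff]
  exact EReal.coe_ne_top (v : ℝ)

theorem ereal_coe_ennreal_sub {u v : ℝ≥0∞} (hu : u ≠ ∞) (hv : v ≠ ∞) :
    (u : EReal) - (v : EReal) = ((u.toReal - v.toReal : ℝ) : EReal) := by
  lift u to NNReal using hu
  lift v to NNReal using hv
  rfl

end EReal

/-! ### The divergence is either infinite or a sum of real divergences -/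

section KLD

variable {d : ℕ} [NeZero d] (f : PMBM d) (π : f.Permutations) (q : PMB f)

theorem kld_eq_top (h : ¬ ∀ a, HasFiniteDivergence (f.w a) (q.w a) f.intensity q.intensity
    (f.permBern π a) q.bern) : kld f π q = ⊤ := by
  push Not at h
  obtain ⟨a, ha⟩ := h
  rw [kld_eq]
  refine ereal_sum_eq_top _ (fun a _ => ereal_coe_ennreal_sub_ne_bot (divergenceNeg_ne_top _ _ _ _ _ _))
    (Finset.mem_univ a) ?_
  have htop : divergencePos (f.w a) (q.w a) f.intensity q.intensity (f.permBern π a) q.bern = ∞ := by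
    by_contra h
    exact ha ((divergencePos_ne_top_iff (f.w_nonneg a)).1 h)
  have hn := divergenceNeg_ne_top (f.w a) (q.w a) f.intensity q.intensity (f.permBern π a) q.bern
  rw [htop]
  generalize divergenceNeg (f.w a) (q.w a) f.intensity q.intensity (f.permBern π a) q.bern = v at hn
  lift v to NNReal using hn
  rfl

theorem kld_eq_coe (h : ∀ a, HasFiniteDivergence (f.w a) (q.w a) f.intensity q.intensity
    (f.permBern π a) q.bern) :
    kld f π q = ((∑ a, pmbDivergence (f.w a) (q.w a) f.intensity q.intensity
      (f.permBern π a) q.bern : ℝ) : EReal) := by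
  rw [kld_eq, ereal_coe_sum]
  refine Finset.sum_congr rfl fun a _ => ?_
  rw [ereal_coe_ennreal_sub ((divergencePos_ne_top_iff (f.w_nonneg a)).2 (h a))
    (divergenceNeg_ne_top _ _ _ _ _ _), toReal_divergencePos_sub (f.w_nonneg a) (h a)]

end KLD

/-! ### Matched parameters and the decomposition into minimum and excess -/

section Matching

variable {d : ℕ} (f : PMBM d) (π : f.Permutations)
  (xbar : (i : Fin f.n) → Fin (f.h i) → Fin d → ℝ)
  (P : (i : Fin f.n) → Fin (f.h i) → Matrix (Fin d) (Fin d) ℝ)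

theorem matchedExistence_nonneg (i : Fin f.n) : 0 ≤ matchedExistence f π i :=
  Finset.sum_nonneg fun a _ => mul_nonneg (f.w_nonneg a) (f.permBern π a i).r_nonneg

theorem matchedExistence_le_one (i : Fin f.n) : matchedExistence f π i ≤ 1 := by
  rw [← f.w_sum]
  exact Finset.sum_le_sum fun a _ =>
    mul_le_of_le_one_right (f.w_nonneg a) (f.permBern π a i).r_le_one

theorem weight_mul_existence_eq_zero {i : Fin f.n} (h : matchedExistence f π i = 0) (a : f.A) :
    f.w a * (f.permBern π a i).r = 0 :=
  (Finset.sum_eq_zero_iff_of_nonneg fun a _ =>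
    mul_nonneg (f.w_nonneg a) (f.permBern π a i).r_nonneg).1 h a (Finset.mem_univ a)

theorem weight_mul_one_sub_existence_eq_zero {i : Fin f.n} (h : 1 - matchedExistence f π i = 0)
    (a : f.A) : f.w a * (1 - (f.permBern π a i).r) = 0 := by
  refine (Finset.sum_eq_zero_iff_of_nonneg (f := fun a => f.w a * (1 - (f.permBern π a i).r))
    fun a _ => mul_nonneg (f.w_nonneg a) (sub_nonneg.2 (f.permBern π a i).r_le_one)).1 ?_ a
      (Finset.mem_univ a)
  simp only [mul_sub, mul_one, Finset.sum_sub_distrib, f.w_sum]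
  exact h

theorem sum_weight_mul_mean (i : Fin f.n) (k : Fin d) :
    ∑ a : f.A, f.w a * (f.permBern π a i).r * xbar (π a i) (a.1 (π a i)) k =
      matchedExistence f π i * matchedMean f π xbar i k := by
  by_cases h : matchedExistence f π i = 0
  · simp [weight_mul_existence_eq_zero f π h, h]
  · rw [matchedMean, Pi.smul_apply, smul_eq_mul, ← mul_assoc, mul_one_div_cancel h, one_mul,
      Finset.sum_apply]
    rfl

/-- The matched covariance matrix, or the identity if no target exists. -/
def matchedCovOrOne (i : Fin f.n) : Matrix (Fin d) (Fin d) ℝ :=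
  if matchedExistence f π i = 0 then 1 else matchedCov f π xbar P i

/-- Expanding the squares about the matched mean, the cross terms collapse by `sum_weight_mul_mean`.
If `r^i = 0`, every weight `w^a r^{a_i}` is zero, so any matrix would do; the identity is chosen to
keep positive definiteness. -/
theorem sum_weight_mul_second_moment (i : Fin f.n) (k l : Fin d) :
    ∑ a : f.A, f.w a * (f.permBern π a i).r * (P (π a i) (a.1 (π a i)) k l +
        xbar (π a i) (a.1 (π a i)) k * xbar (π a i) (a.1 (π a i)) l) =
      matchedExistence f π i * (matchedCovOrOne f π xbar P i k l +
        matchedMean f π xbar i k * matchedMean f π xbar i l) := by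
  by_cases h : matchedExistence f π i = 0
  · simp [weight_mul_existence_eq_zero f π h, h]
  have hcov : matchedExistence f π i * matchedCov f π xbar P i k l =
      ∑ a : f.A, f.w a * (f.permBern π a i).r * (P (π a i) (a.1 (π a i)) k l +
        (xbar (π a i) (a.1 (π a i)) k - matchedMean f π xbar i k) *
          (xbar (π a i) (a.1 (π a i)) l - matchedMean f π xbar i l)) := by
    rw [matchedCov, Matrix.smul_apply, smul_eq_mul, ← mul_assoc, mul_one_div_cancel h, one_mul,
      Matrix.sum_apply]
    rfl
  have hk := sum_weight_mul_mean f π xbar i k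
  have hl := sum_weight_mul_mean f π xbar i l
  have hR : ∑ a : f.A, f.w a * (f.permBern π a i).r = matchedExistence f π i := rfl
  rw [matchedCovOrOne, if_neg h, mul_add, hcov]
  generalize matchedMean f π xbar i = mb at *
  have hexp (a : f.A) : f.w a * (f.permBern π a i).r * (P (π a i) (a.1 (π a i)) k l +
        (xbar (π a i) (a.1 (π a i)) k - mb k) * (xbar (π a i) (a.1 (π a i)) l - mb l)) =
      f.w a * (f.permBern π a i).r * (P (π a i) (a.1 (π a i)) k l +
        xbar (π a i) (a.1 (π a i)) k * xbar (π a i) (a.1 (π a i)) l) -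
      f.w a * (f.permBern π a i).r * xbar (π a i) (a.1 (π a i)) k * mb l -
      f.w a * (f.permBern π a i).r * xbar (π a i) (a.1 (π a i)) l * mb k +
      f.w a * (f.permBern π a i).r * (mb k * mb l) := by ring
  rw [Finset.sum_congr rfl fun a _ => hexp a, Finset.sum_add_distrib, Finset.sum_sub_distrib,
    Finset.sum_sub_distrib, ← Finset.sum_mul, ← Finset.sum_mul, ← Finset.sum_mul, hk, hl, hR]
  ring

/-- If `r^i ≠ 0`, some hypothesis has positive weight and contributes a positive definite matrix;
all others contribute positive semidefinite ones. -/
theorem posDef_matchedCovOrOne (hP : ∀ i l, (P i l).PosDef) (i : Fin f.n) :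
    (matchedCovOrOne f π xbar P i).PosDef := by
  unfold matchedCovOrOne
  split_ifs with h
  · exact Matrix.PosDef.one
  have hR : 0 < matchedExistence f π i :=
    lt_of_le_of_ne (matchedExistence_nonneg f π i) (Ne.symm h)
  obtain ⟨a₀, ha₀⟩ : ∃ a : f.A, f.w a * (f.permBern π a i).r ≠ 0 := by
    by_contra! h'
    exact h (Finset.sum_eq_zero fun a _ => h' a)
  have hc (a : f.A) : 0 ≤ f.w a * (f.permBern π a i).r :=
    mul_nonneg (f.w_nonneg a) (f.permBern π a i).r_nonneg
  have hpd (a : f.A) : (P (π a i) (a.1 (π a i)) + Matrix.vecMulVec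
      (xbar (π a i) (a.1 (π a i)) - matchedMean f π xbar i)
      (xbar (π a i) (a.1 (π a i)) - matchedMean f π xbar i)).PosDef := by
    refine (hP _ _).add_posSemidef ?_
    have := Matrix.posSemidef_vecMulVec_self_star
      (xbar (π a i) (a.1 (π a i)) - matchedMean f π xbar i)
    rwa [star_trivial] at this
  unfold matchedCov
  refine Matrix.PosDef.smul ?_ (one_div_pos.2 hR)
  rw [← Finset.add_sum_erase _ _ (Finset.mem_univ a₀)]
  refine ((hpd a₀).smul (lt_of_le_of_ne (hc a₀) ha₀.symm)).add_posSemidef ?_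
  exact Matrix.posSemidef_sum _ fun a _ => (hpd a).posSemidef.smul (hc a)

/-- The Bernoulli density with a Gaussian single-target density. -/
def gaussianBernoulli {r : ℝ} (hr : 0 ≤ r) (hr1 : r ≤ 1) (m : Fin d → ℝ)
    {C : Matrix (Fin d) (Fin d) ℝ} (hC : C.PosDef) : BernoulliParam d where
  r := r
  p := gaussianDensity m C
  r_nonneg := hr
  r_le_one := hr1
  p_measurable := measurable_gaussianDensity m C
  p_nonneg x := (gaussianDensity_pos m hC x).le
  p_integral := integral_gaussianDensity m hC

/-- The Poisson multi-Bernoulli density with matched moments. -/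
def matchedPMB (hP : ∀ i l, (P i l).PosDef) : PMB f where
  w := f.w
  w_nonneg := f.w_nonneg
  w_sum := f.w_sum
  intensity := f.intensity
  bern i := gaussianBernoulli (matchedExistence_nonneg f π i) (matchedExistence_le_one f π i)
    (matchedMean f π xbar i) (posDef_matchedCovOrOne f π xbar P hP i)

/-- The parameters of `q` are the matched ones. -/
def IsMatched (q : PMB f) (m : Fin f.n → Fin d → ℝ)
    (C : Fin f.n → Matrix (Fin d) (Fin d) ℝ) : Prop :=
  (∀ a, q.w a = f.w a) ∧
    q.intensity.val =ᵐ[volume] f.intensity.val ∧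
    ∀ i, (q.bern i).r = matchedExistence f π i ∧
      (matchedExistence f π i ≠ 0 →
        m i = matchedMean f π xbar i ∧ C i = matchedCov f π xbar P i)

theorem isMatched_matchedPMB (hP : ∀ i l, (P i l).PosDef) :
    IsMatched f π xbar P (matchedPMB f π xbar P hP) (matchedMean f π xbar)
      (matchedCovOrOne f π xbar P) :=
  ⟨fun _ => rfl, Filter.EventuallyEq.rfl, fun _ => ⟨rfl, fun h => ⟨rfl, if_neg h⟩⟩⟩

/-- The excess of the divergence of `q` over the minimal one. -/
def divergenceExcess (q : PMB f) (m : Fin f.n → Fin d → ℝ)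
    (C : Fin f.n → Matrix (Fin d) (Fin d) ℝ) : ℝ :=
  ∑ a, gibbsTerm (f.w a) (q.w a) + (∫ x, gibbsTerm (f.intensity.val x) (q.intensity.val x)) +
    ∑ i, bernoulliExcess (matchedExistence f π i) (matchedMean f π xbar i)
      (matchedCovOrOne f π xbar P i) (q.bern i).r (m i) (C i)

/-- The minimal divergence. -/
def minimalDivergence : ℝ :=
  ∑ i, (∑ a : f.A, f.w a * ((f.permBern π a i).r * Real.log (f.permBern π a i).r +
      (1 - (f.permBern π a i).r) * Real.log (1 - (f.permBern π a i).r) +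
      (f.permBern π a i).r * ∫ x, Real.log (gaussianDensity (xbar (π a i) (a.1 (π a i)))
        (P (π a i) (a.1 (π a i))) x)
          ∂(gaussianMeasure (xbar (π a i) (a.1 (π a i))) (P (π a i) (a.1 (π a i))))) -
    (matchedExistence f π i * Real.log (matchedExistence f π i) +
      (1 - matchedExistence f π i) * Real.log (1 - matchedExistence f π i) +
      matchedExistence f π i * ∫ x, Real.log (gaussianDensity (matchedMean f π xbar i)
        (matchedCovOrOne f π xbar P i) x)
          ∂(gaussianMeasure (matchedMean f π xbar i) (matchedCovOrOne f π xbar P i))))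

variable {f π xbar P} {q : PMB f} {m : Fin f.n → Fin d → ℝ}
  {C : Fin f.n → Matrix (Fin d) (Fin d) ℝ}

theorem PMBM.exists_weight_ne_zero (f : PMBM d) : ∃ a, f.w a ≠ 0 := by
  by_contra! h
  have := f.w_sum
  simp [h] at this

theorem existence_eq_zero_of_hasFiniteDivergence (hP : ∀ i l, (P i l).PosDef)
    (hf : ∀ i l, (f.bern i l).p = gaussianDensity (xbar i l) (P i l))
    (h : ∀ a, HasFiniteDivergence (f.w a) (q.w a) f.intensity q.intensity
      (f.permBern π a) q.bern) {a : f.A} (ha : f.w a ≠ 0) {i : Fin f.n}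
    (hr : (q.bern i).r = 0) : (f.permBern π a i).r = 0 := by
  obtain ⟨-, -, h3⟩ := h a ha
  -- The implication between zeros holds almost everywhere, hence at some point, and one point
  -- suffices because the Gaussian density is positive everywhere.
  obtain ⟨x, hx⟩ := (h3 i).1.1.exists
  refine (mul_eq_zero.1 (hx (by rw [hr, zero_mul]))).resolve_right ?_
  rw [PMBM.permBern, hf]
  exact (gaussianDensity_pos _ (hP _ _) x).ne'

/-- If `r^i` is `0` or `1`, it is an extreme value of an average, so every component of nonzero
weight has the same existence probability. The zeros of `q` are therefore compatible with those of
the mixture. -/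
theorem hasFiniteDivergence_of_isMatched (hP : ∀ i l, (P i l).PosDef)
    (hf : ∀ i l, (f.bern i l).p = gaussianDensity (xbar i l) (P i l))
    (hC : ∀ i, (C i).PosDef) (hq : ∀ i, (q.bern i).p = gaussianDensity (m i) (C i))
    (h : IsMatched f π xbar P q m C) (a : f.A) :
    HasFiniteDivergence (f.w a) (q.w a) f.intensity q.intensity (f.permBern π a) q.bern := by
  obtain ⟨h1, h2, h3⟩ := h
  intro ha
  refine ⟨by rwa [h1], ⟨?_, ?_⟩, fun i => ?_⟩
  · filter_upwards [h2] with x hx h0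
    rwa [← hx]
  · refine (integrable_zero _ _ _).congr ?_
    filter_upwards [h2] with x hx
    rw [hx]
    by_cases h0 : f.intensity.val x = 0 <;> simp [h0]
  · have hr : (q.bern i).r = 0 → (f.permBern π a i).r = 0 := fun h0 => by
      rw [(h3 i).1] at h0
      exact (mul_eq_zero.1 (weight_mul_existence_eq_zero f π h0 a)).resolve_left ha
    have hp : (f.permBern π a i).p =
        gaussianDensity (xbar (π a i) (a.1 (π a i))) (P (π a i) (a.1 (π a i))) := hf _ _
    rw [hp, hq]
    refine ⟨⟨Filter.Eventually.of_forall fun x h0 => ?_,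
      integrable_bernoulli_mul_log (hP _ _) (hC i) hr⟩, fun h0 => ?_⟩
    · rw [hr ((mul_eq_zero.1 h0).resolve_right (gaussianDensity_pos _ (hC i) x).ne'), zero_mul]
    · rw [(h3 i).1] at h0
      exact (mul_eq_zero.1 (weight_mul_one_sub_existence_eq_zero f π h0 a)).resolve_left ha

/-- The Poisson part does not depend on `a` and is averaged with total weight `1`; each track is
handled by `sum_bernoulli_divergence_eq` with the matched moments. -/
theorem sum_pmbDivergence_eq (hP : ∀ i l, (P i l).PosDef)
    (hf : ∀ i l, (f.bern i l).p = gaussianDensity (xbar i l) (P i l))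
    (hC : ∀ i, (C i).PosDef) (hq : ∀ i, (q.bern i).p = gaussianDensity (m i) (C i))
    (h : ∀ a, HasFiniteDivergence (f.w a) (q.w a) f.intensity q.intensity
      (f.permBern π a) q.bern) :
    ∑ a, pmbDivergence (f.w a) (q.w a) f.intensity q.intensity (f.permBern π a) q.bern =
      minimalDivergence f π xbar P + divergenceExcess f π xbar P q m C := by
  have hp (a : f.A) (i : Fin f.n) : (f.permBern π a i).p =
      gaussianDensity (xbar (π a i) (a.1 (π a i))) (P (π a i) (a.1 (π a i))) := hf _ _
  have htrack (i : Fin f.n) := sum_bernoulli_divergence_eq (m := matchedMean f π xbar i)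
    (m' := m i) Finset.univ (w := f.w) (r := fun a => (f.permBern π a i).r)
    (ms := fun a => xbar (π a i) (a.1 (π a i))) (Cs := fun a => P (π a i) (a.1 (π a i)))
    (fun a => hP _ _) (R := matchedExistence f π i) (posDef_matchedCovOrOne f π xbar P hP i)
    f.w_sum rfl (sum_weight_mul_mean f π xbar i) (sum_weight_mul_second_moment f π xbar P i)
    (r' := (q.bern i).r) (hC i)
    (fun a _ ha hr => existence_eq_zero_of_hasFiniteDivergence hP hf h ha hr)
    (fun a _ ha => ((h a ha).2.2 i).2)
  obtain ⟨a₀, ha₀⟩ := f.exists_weight_ne_zero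
  have hint := integral_gibbsTerm f.intensity.integrable q.intensity.integrable (h a₀ ha₀).2.1.2
  -- The difference `f.w a - q.w a` completes `w log (w / w')` to a Gibbs term and disappears on
  -- summation, both families of weights having sum `1`.
  have hterm (a : f.A) :
      pmbDivergence (f.w a) (q.w a) f.intensity q.intensity (f.permBern π a) q.bern =
      gibbsTerm (f.w a) (q.w a) + (f.w a - q.w a) +
        f.w a * (∫ x, gibbsTerm (f.intensity.val x) (q.intensity.val x)) +
        ∑ i, f.w a * ((∫ x, (f.permBern π a i).r * gaussianDensity (xbar (π a i) (a.1 (π a i)))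
            (P (π a i) (a.1 (π a i))) x * Real.log ((f.permBern π a i).r *
            gaussianDensity (xbar (π a i) (a.1 (π a i))) (P (π a i) (a.1 (π a i))) x /
            ((q.bern i).r * gaussianDensity (m i) (C i) x))) +
          (1 - (f.permBern π a i).r) *
            Real.log ((1 - (f.permBern π a i).r) / (1 - (q.bern i).r))) := by
    rw [pmbDivergence, hint, gibbsTerm, ← Finset.mul_sum]
    simp only [hp, hq]
    ring
  rw [Finset.sum_congr rfl fun a _ => hterm a, Finset.sum_add_distrib, Finset.sum_add_distrib,
    Finset.sum_add_distrib, Finset.sum_sub_distrib, f.w_sum, q.w_sum, ← Finset.sum_mul, f.w_sum,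
    Finset.sum_comm, Finset.sum_congr rfl fun i _ => htrack i, Finset.sum_add_distrib,
    minimalDivergence, divergenceExcess]
  ring

/-- All terms of the excess are nonnegative by Gibbs' inequality, so it vanishes only if each term
does. Finiteness of the divergence provides the conditions on zeros that the inequality requires. -/
theorem divergenceExcess_nonneg_and_eq_zero_iff (hP : ∀ i l, (P i l).PosDef)
    (hf : ∀ i l, (f.bern i l).p = gaussianDensity (xbar i l) (P i l))
    (hC : ∀ i, (C i).PosDef)
    (h : ∀ a, HasFiniteDivergence (f.w a) (q.w a) f.intensity q.intensity
      (f.permBern π a) q.bern) :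
    0 ≤ divergenceExcess f π xbar P q m C ∧
      (divergenceExcess f π xbar P q m C = 0 ↔ IsMatched f π xbar P q m C) := by
  obtain ⟨a₀, ha₀⟩ := f.exists_weight_ne_zero
  obtain ⟨-, ⟨hac, hint⟩, -⟩ := h a₀ ha₀
  have hw (a : f.A) (h0 : q.w a = 0) : f.w a = 0 := by
    by_contra ha
    exact (h a ha).1 h0
  have hr0 (i : Fin f.n) (h0 : (q.bern i).r = 0) : matchedExistence f π i = 0 := by
    refine Finset.sum_eq_zero fun a _ => ?_
    by_cases ha : f.w a = 0
    · rw [ha, zero_mul]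
    · rw [existence_eq_zero_of_hasFiniteDivergence hP hf h ha h0, mul_zero]
  have hr1 (i : Fin f.n) (h0 : 1 - (q.bern i).r = 0) : 1 - matchedExistence f π i = 0 := by
    rw [matchedExistence, ← f.w_sum, ← Finset.sum_sub_distrib]
    refine Finset.sum_eq_zero fun a _ => ?_
    by_cases ha : f.w a = 0
    · rw [ha, zero_mul, sub_zero]
    · linear_combination f.w a * ((h a ha).2.2 i).2 h0
  have n1 (a : f.A) : 0 ≤ gibbsTerm (f.w a) (q.w a) :=
    gibbsTerm_nonneg (f.w_nonneg a) (q.w_nonneg a) (hw a)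
  have n2 := integral_gibbsTerm_nonneg f.intensity.nonneg q.intensity.nonneg hac
  have hpd := posDef_matchedCovOrOne f π xbar P hP
  have n3 (i : Fin f.n) := bernoulliExcess_nonneg (m := matchedMean f π xbar i) (m' := m i)
    (matchedExistence_nonneg f π i) (matchedExistence_le_one f π i) (q.bern i).r_nonneg
    (q.bern i).r_le_one (hr0 i) (hr1 i) (hpd i) (hC i)
  have s1 := Finset.sum_nonneg fun a (_ : a ∈ Finset.univ) => n1 a
  have s3 := Finset.sum_nonneg fun i (_ : i ∈ Finset.univ) => n3 i
  refine ⟨add_nonneg (add_nonneg s1 n2) s3, ?_⟩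
  have z3 (i : Fin f.n) := bernoulliExcess_eq_zero_iff (m := matchedMean f π xbar i) (m' := m i)
    (matchedExistence_nonneg f π i) (matchedExistence_le_one f π i) (q.bern i).r_nonneg
    (q.bern i).r_le_one (hr0 i) (hr1 i) (hpd i) (hC i)
  rw [divergenceExcess, add_eq_zero_iff_of_nonneg (add_nonneg s1 n2) s3,
    add_eq_zero_iff_of_nonneg s1 n2, Finset.sum_eq_zero_iff_of_nonneg fun a _ => n1 a,
    Finset.sum_eq_zero_iff_of_nonneg fun i _ => n3 i,
    integral_gibbsTerm_eq_zero_iff f.intensity.nonneg q.intensity.nonneg f.intensity.integrable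
      q.intensity.integrable hint hac]
  simp only [Finset.mem_univ, true_imp_iff, z3,
    gibbsTerm_eq_zero_iff (f.w_nonneg _) (q.w_nonneg _) (hw _)]
  have hcov (i : Fin f.n) (hi : matchedExistence f π i ≠ 0) :
      matchedCovOrOne f π xbar P i = matchedCov f π xbar P i := if_neg hi
  constructor
  · rintro ⟨⟨h1, h2⟩, h3⟩
    exact ⟨fun a => (h1 a).symm, h2.symm, fun i => ⟨(h3 i).1, fun hi =>
      ⟨((h3 i).2 hi).1, ((h3 i).2 hi).2.trans (hcov i hi)⟩⟩⟩
  · rintro ⟨h1, h2, h3⟩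
    exact ⟨⟨fun a => (h1 a).symm, h2.symm⟩, fun i => ⟨(h3 i).1, fun hi =>
      ⟨((h3 i).2 hi).1, ((h3 i).2 hi).2.trans (hcov i hi).symm⟩⟩⟩

variable [NeZero d]

theorem minimalDivergence_le_kld (hP : ∀ i l, (P i l).PosDef)
    (hf : ∀ i l, (f.bern i l).p = gaussianDensity (xbar i l) (P i l))
    (hC : ∀ i, (C i).PosDef) (hq : ∀ i, (q.bern i).p = gaussianDensity (m i) (C i)) :
    (minimalDivergence f π xbar P : EReal) ≤ kld f π q := by
  by_cases h : ∀ a, HasFiniteDivergence (f.w a) (q.w a) f.intensity q.intensity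
      (f.permBern π a) q.bern
  · rw [kld_eq_coe f π q h, sum_pmbDivergence_eq hP hf hC hq h, EReal.coe_le_coe_iff]
    exact le_add_of_nonneg_right (divergenceExcess_nonneg_and_eq_zero_iff hP hf hC h).1
  · rw [kld_eq_top f π q h]
    exact le_top

theorem kld_eq_minimalDivergence_iff (hP : ∀ i l, (P i l).PosDef)
    (hf : ∀ i l, (f.bern i l).p = gaussianDensity (xbar i l) (P i l))
    (hC : ∀ i, (C i).PosDef) (hq : ∀ i, (q.bern i).p = gaussianDensity (m i) (C i)) :
    kld f π q = minimalDivergence f π xbar P ↔ IsMatched f π xbar P q m C := by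
  by_cases h : ∀ a, HasFiniteDivergence (f.w a) (q.w a) f.intensity q.intensity
      (f.permBern π a) q.bern
  · rw [kld_eq_coe f π q h, sum_pmbDivergence_eq hP hf hC hq h, EReal.coe_eq_coe_iff,
      add_eq_left]
    exact (divergenceExcess_nonneg_and_eq_zero_iff hP hf hC h).2
  · rw [kld_eq_top f π q h]
    exact ⟨fun h' => absurd h'.symm (EReal.coe_ne_top _),
      fun h' => absurd (hasFiniteDivergence_of_isMatched hP hf hC hq h') h⟩

/-- The lower bound `minimalDivergence` is attained by `matchedPMB`, so optimality means attaining
it, that is, having matched parameters. -/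
theorem isOptimalGaussianPMB_iff (hP : ∀ i l, (P i l).PosDef)
    (hf : ∀ i l, (f.bern i l).p = gaussianDensity (xbar i l) (P i l))
    (hC : ∀ i, (C i).PosDef) (hq : ∀ i, (q.bern i).p = gaussianDensity (m i) (C i)) :
    IsOptimalGaussianPMB f π q ↔ IsMatched f π xbar P q m C := by
  have hpd := posDef_matchedCovOrOne f π xbar P hP
  rw [← kld_eq_minimalDivergence_iff hP hf hC hq]
  constructor
  · intro h
    refine le_antisymm ?_ (minimalDivergence_le_kld hP hf hC hq)
    rw [← (kld_eq_minimalDivergence_iff hP hf hpd fun _ => rfl).2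
      (isMatched_matchedPMB f π xbar P hP)]
    exact h.2 _ fun i => ⟨_, _, hpd i, rfl⟩
  · intro h
    refine ⟨fun i => ⟨m i, C i, hC i, hq i⟩, fun q' hq' => ?_⟩
    choose m' C' hC' hp' using hq'
    rw [h]
    exact minimalDivergence_le_kld hP hf hC' hp'

end Matching

end

theorem lemma4 {d : ℕ} (hd : 0 < d) (f : PMBM d)
    (xbar : (i : Fin f.n) → Fin (f.h i) → Fin d → ℝ)
    (P : (i : Fin f.n) → Fin (f.h i) → Matrix (Fin d) (Fin d) ℝ)
    (hP : ∀ i l, (P i l).PosDef)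
    (hf : ∀ i l, (f.bern i l).p = gaussianDensity (xbar i l) (P i l))
    (π : f.Permutations) :
    (∃ q : PMB f, IsOptimalGaussianPMB f π q) ∧
    ∀ (q : PMB f) (m : Fin f.n → Fin d → ℝ) (C : Fin f.n → Matrix (Fin d) (Fin d) ℝ),
      (∀ i, (C i).PosDef) → (∀ i, (q.bern i).p = gaussianDensity (m i) (C i)) →
      (IsOptimalGaussianPMB f π q ↔
        (∀ a, q.w a = f.w a) ∧
        q.intensity.val =ᵐ[volume] f.intensity.val ∧
        ∀ i, (q.bern i).r = matchedExistence f π i ∧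
          (matchedExistence f π i ≠ 0 →
            m i = matchedMean f π xbar i ∧ C i = matchedCov f π xbar P i)) := by
  have : NeZero d := ⟨hd.ne'⟩
  refine ⟨⟨matchedPMB f π xbar P hP, ?_⟩, fun q m C hC hq => isOptimalGaussianPMB_iff hP hf hC hq⟩
  exact (isOptimalGaussianPMB_iff hP hf (posDef_matchedCovOrOne f π xbar P hP) fun _ => rfl).2
    (isMatched_matchedPMB f π xbar P hP)
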